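/- **Conventions.** Let $\mathsf B$ be a semi-abelian category (pointed, Barr-exact, Bourn-protomodular, with finite coproducts). For objects $C,B$ let $C\flat B$ be the kernel of $[1,0]\colon C+B\to C$. An *action* of $C$ on $B$ is an algebra structure $\xi\colon C\flat B\to B$ for the monad $C\flat(-)$. It is *abelian* if it is the conjugation action of $C$ on the kernel $B$ of a Beck module over $C$, i.e. if there is an internal abelian group $p\colon A\to C$ in $\mathsf B/C$, with zero section $s$ and kernel $k\colon B\to A$, such that $k\xi$ is the restriction of $[s,k]\colon C+B\to A$ to $C\flat B$. A morphism $(\varphi_0,\varphi_1)\colon\xi\to\xi'$ from an action $\xi$ of $C$ on $B$ to an action $\xi'$ of $C'$ on $B'$ is a pair $\varphi_0\colon C\to C'$, $\varphi_1\colon B\to B'$ with $\xi'\circ(\varphi_0\flat\varphi_1)=\varphi_1\circ\xi$. For $g\colon D\to C$ put $g^*\xi=\xi\circ(g\flat 1)$. An *abelian extension* $E=(f,k)$ of $C$ by $B$ is a regular epimorphism $f\colon E\to C$ with kernel $k\colon B\to E$ such that $f$ admits, as an object of $\mathsf B/C$, an autonomous (associative and commutative) Mal'tsev operation. It *induces*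 an abelian action $\xi$ of $C$ on $B$, determined by the condition that $k\circ\xi\circ(f\flat 1)$ is the restriction of $[1,k]\colon E+B\to E$ to $E\flat B$. A morphism $E\to E'$ *inducing* $(\varphi_0,\varphi_1)$ is a morphism $g\colon E\to E'$ of $\mathsf B$ with $gk=k'\varphi_1$ and $f'g=\varphi_0f$; these form the set $\mathrm{OPEXT}_{(\varphi_0,\varphi_1)}(E,E')$. Let $\mathrm{OPEXT}(C,B,\xi)$ be the category of abelian extensions of $C$ by $B$ inducing $\xi$, with the morphisms inducing $(1_C,1_B)$. Under the Baer sum it is a categorical group, whose identity object is the semidirect product extension of $\xi$ (the Beck module associated with $\xi$, with its zero section $s$); $\pi_1(\mathrm{OPEXT}(C,B,\xi))$ is the automorphism group of this identity object. **Theorem.** Let $E=(f,k)$ and $E'=(f',k')$ be abelian extensions in $\mathsf B$, of $C$ by $B$ and of $C'$ by $B'$, inducing the abelian actions $\xi$ and $\xi'$, and let $(\varphi_0,\varphi_1)\colon\xi\to\xi'$ be a morphism of actions. Let $\varphi_0^*E'\in\mathrm{OPEXT}(C,B',\varphi_0^*\xi')$ be the pullback of $E'$ along $\varphi_0$. Then: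 (i) The push forward $\varphi_{1*}E\in\mathrm{OPEXT}(C,B',\varphi_0^*\xi')$ exists, i.e. $(1_C,\varphi_1)\colon\xi\to\varphi_0^*\xi'$ has an opcartesian lifting $E\to\varphi_{1*}E$ with respect to the functor from abelian extensions of $C$ to abelian actions of $C$. There exists a morphism of extensions $E\to E'$ inducing $(\varphi_0,\varphi_1)$ if and only if $\varphi_0^*E'\cong\varphi_{1*}E$ in $\mathrm{OPEXT}(C,B',\varphi_0^*\xi')$, for any choice of the push forward. (ii) If such morphisms exist, $\mathrm{OPEXT}_{(\varphi_0,\varphi_1)}(E,E')$ is a simply transitive $\pi_1(\mathrm{OPEXT}(C,B',\varphi_0^*\xi'))$-set. The action is the canonical one: write $X=\varphi_0^*E'$, with projection $\bar f\colon X\to C$, and let $A\to C$ be the identity object with zero section $s$. There are a morphism $\tau\colon X\times_CA\to X$ over $C$ with $\tau(1_X,s\bar f)=1_X$ and with $\tau(0,k_A)=k_X$, where $k_A,k_X$ are the kernel inclusions of $B'$, and a group isomorphism $\theta\colon\pi_1\to\mathrm{Aut}(X)$ with $\tau\circ(1\times_Ca)=\theta(a)\circ\tau$ for all $a$, such that $a\in\pi_1$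 acts by $$a\cdot g=\bigl(E\xrightarrow{(g,f)}X\xrightarrow{\theta(a)}X\xrightarrow{\mathrm{pr}}E'\bigr).$$ -/

import Mathlib

open CategoryTheory Limits

universe v u

namespace SemiAb

/-- `k` is a kernel of `f`. -/
def IsKer {𝒞 : Type u} [Category.{v} 𝒞] [HasZeroMorphisms 𝒞] {B E C : 𝒞}
    (k : B ⟶ E) (f : E ⟶ C) : Prop :=
  ∃ w : k ≫ f = 0, Nonempty (IsLimit (KernelFork.ofι k w))

/-- A semi-abelian category: pointed, Barr-exact (regular, and every internal equivalence relation
is effective), with finite coproducts, and Bourn-protomodular (for a pointed category with finite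
limits this is the split short five lemma). -/
class SemiAbelian (𝒞 : Type u) [Category.{v} 𝒞] [HasZeroMorphisms 𝒞] : Prop where
  regular : Regular 𝒞
  hasZeroObject : HasZeroObject 𝒞
  hasFiniteCoproducts : HasFiniteCoproducts 𝒞
  effective : ∀ {R X : 𝒞} (p₁ p₂ : R ⟶ X), IsEquivalenceRelation p₁ p₂ →
    IsEffectiveEquivalenceRelation p₁ p₂
  splitShortFive : ∀ {B A C B' A' C' : 𝒞}
    {k : B ⟶ A} {p : A ⟶ C} {s : C ⟶ A} {k' : B' ⟶ A'} {p' : A' ⟶ C'} {s' : C' ⟶ A'}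
    (β : B ⟶ B') (α : A ⟶ A') (γ : C ⟶ C'),
    IsKer k p → IsKer k' p' → s ≫ p = 𝟙 C → s' ≫ p' = 𝟙 C' →
    k ≫ α = β ≫ k' → p ≫ γ = α ≫ p' → s ≫ α = γ ≫ s' →
    IsIso β → IsIso γ → IsIso α

attribute [instance] SemiAbelian.regular SemiAbelian.hasZeroObject SemiAbelian.hasFiniteCoproducts

section Kernels

variable {𝒞 : Type u} [Category.{v} 𝒞] [HasZeroMorphisms 𝒞] {B E C : 𝒞} {k : B ⟶ E} {f : E ⟶ C}

theorem IsKer.mono (h : IsKer k f) : Mono k := by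
  obtain ⟨w, ⟨hl⟩⟩ := h
  exact mono_of_isLimit_fork hl

theorem IsKer.exists_lift (h : IsKer k f) {T : 𝒞} (x : T ⟶ E) (hx : x ≫ f = 0) :
    ∃ y : T ⟶ B, y ≫ k = x := by
  obtain ⟨w, ⟨hl⟩⟩ := h
  obtain ⟨l, hl'⟩ := KernelFork.IsLimit.lift' hl x hx
  exact ⟨l, by simpa using hl'⟩

theorem IsKer.of_lift (w : k ≫ f = 0) (hk : Mono k)
    (h : ∀ {T : 𝒞} (x : T ⟶ E), x ≫ f = 0 → ∃ y : T ⟶ B, y ≫ k = x) : IsKer k f :=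
  ⟨w, ⟨KernelFork.IsLimit.ofι' k w fun x hx => ⟨(h x hx).choose, (h x hx).choose_spec⟩⟩⟩

end Kernels

noncomputable section

/-! ### Internal actions -/

attribute [local simp] pullback.lift_fst pullback.lift_snd pullback.lift_fst_assoc
  pullback.lift_snd_assoc coprod.inl_desc coprod.inr_desc coprod.inl_desc_assoc
  coprod.inr_desc_assoc

section Actions

variable {𝒞 : Type u} [Category.{v} 𝒞] [HasZeroMorphisms 𝒞] [SemiAbelian 𝒞]

/-- The object `C ♭ B`, the kernel of `[1, 0] : C + B ⟶ C`. -/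
def flat (C B : 𝒞) : 𝒞 := kernel (coprod.desc (𝟙 C) (0 : B ⟶ C))

/-- The kernel inclusion `C ♭ B ⟶ C + B`. -/
def flatι (C B : 𝒞) : flat C B ⟶ C ⨿ B := kernel.ι _

instance (C B : 𝒞) : Mono (flatι C B) := inferInstanceAs (Mono (kernel.ι _))

theorem flatι_desc (C B : 𝒞) : flatι C B ≫ coprod.desc (𝟙 C) (0 : B ⟶ C) = 0 :=
  kernel.condition _

/-- A morphism into `C + B` killed by `[1, 0]` factors through `C ♭ B`. -/
def flatLift {C B T : 𝒞} (x : T ⟶ C ⨿ B) (hx : x ≫ coprod.desc (𝟙 C) (0 : B ⟶ C) = 0) :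
    T ⟶ flat C B := kernel.lift _ x hx

@[simp]
theorem flatLift_ι {C B T : 𝒞} (x : T ⟶ C ⨿ B)
    (hx : x ≫ coprod.desc (𝟙 C) (0 : B ⟶ C) = 0) : flatLift x hx ≫ flatι C B = x :=
  kernel.lift_ι _ _ _

/-- Functoriality of `C ♭ B` in both variables. -/
def flatMap {C B C' B' : 𝒞} (g : C ⟶ C') (b : B ⟶ B') : flat C B ⟶ flat C' B' :=
  flatLift (flatι C B ≫ coprod.map g b) (by
    have : coprod.map g b ≫ coprod.desc (𝟙 C') (0 : B' ⟶ C') =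
        coprod.desc (𝟙 C) (0 : B ⟶ C) ≫ g := by ext <;> simp
    rw [Category.assoc, this, ← Category.assoc, flatι_desc, zero_comp])

@[simp]
theorem flatMap_ι {C B C' B' : 𝒞} (g : C ⟶ C') (b : B ⟶ B') :
    flatMap g b ≫ flatι C' B' = flatι C B ≫ coprod.map g b := flatLift_ι _ _

/-- The unit of the monad `C ♭ -`. -/
def flatη (C B : 𝒞) : B ⟶ flat C B := flatLift coprod.inr (by simp)

@[simp]
theorem flatη_ι (C B : 𝒞) : flatη C B ≫ flatι C B = coprod.inr := flatLift_ι _ _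

/-- The multiplication of the monad `C ♭ -`. -/
def flatμ (C B : 𝒞) : flat C (flat C B) ⟶ flat C B :=
  flatLift (flatι C (flat C B) ≫ coprod.desc coprod.inl (flatι C B)) (by
    have : coprod.desc coprod.inl (flatι C B) ≫ coprod.desc (𝟙 C) (0 : B ⟶ C) =
        coprod.desc (𝟙 C) 0 := by ext <;> simp [flatι_desc]
    rw [Category.assoc, this, flatι_desc])

@[simp]
theorem flatμ_ι (C B : 𝒞) : flatμ C B ≫ flatι C B =
    flatι C (flat C B) ≫ coprod.desc coprod.inl (flatι C B) := flatLift_ι _ _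

/-- An internal action of `C` on `B`: an algebra structure on `B` for the monad `C ♭ -`. -/
structure InternalAction (C B : 𝒞) where
  act : flat C B ⟶ B
  unit : flatη C B ≫ act = 𝟙 B
  assoc : flatμ C B ≫ act = flatMap (𝟙 C) act ≫ act

/-- `act : C ♭ B ⟶ B` is the action (by conjugation) of `C` on the kernel `k : B ⟶ A` of a split
epimorphism `A ⟶ C` with section `s : C ⟶ A`. -/
def IsConjugation {C B A : 𝒞} (act : flat C B ⟶ B) (s : C ⟶ A) (k : B ⟶ A) : Prop :=
  act ≫ k = flatι C B ≫ coprod.desc s k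

attribute [local instance] Over.cartesianMonoidalCategory Over.braidedCategory

/-- `p : A ⟶ C` underlies an internal abelian group in the slice category over `C` (a Beck module
over `C`) whose zero section is `s`. -/
def IsBeckModule {A C : 𝒞} (p : A ⟶ C) (s : C ⟶ A) : Prop :=
  ∃ i : CommGrpObj (Over.mk p), i.one.left = s

/-- An abelian action of `C` on `B`: an internal action associated with a Beck module, i.e. such
that `B` is the kernel of a Beck module over `C` on which `C` acts by conjugation via the
zero section. -/
structure AbAction (C B : 𝒞) extends InternalAction C B where
  beck : ∃ (A : 𝒞) (p : A ⟶ C) (s : C ⟶ A) (k : B ⟶ A),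
    IsBeckModule p s ∧ IsKer k p ∧ IsConjugation act s k

theorem IsBeckModule.section_comp {A C : 𝒞} {p : A ⟶ C} {s : C ⟶ A} (h : IsBeckModule p s) :
    s ≫ p = 𝟙 C := by
  obtain ⟨i, rfl⟩ := h
  exact Over.w i.one

theorem IsBeckModule.of_ops {A C : 𝒞} {p : A ⟶ C} {s : C ⟶ A} (hs : s ≫ p = 𝟙 C)
    (add : pullback p p ⟶ A) (hadd : add ≫ p = pullback.fst p p ≫ p)
    (neg : A ⟶ A) (hneg : neg ≫ p = p)
    (zero_add : ∀ {T : 𝒞} (x : T ⟶ A),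
      pullback.lift (f := p) (g := p) (x ≫ p ≫ s) x (by simp [hs]) ≫ add = x)
    (neg_add : pullback.lift (f := p) (g := p) neg (𝟙 A) (by simp [hneg]) ≫ add = p ≫ s)
    (comm : ∀ {T : 𝒞} (x y : T ⟶ A) (h : x ≫ p = y ≫ p),
      pullback.lift x y h ≫ add = pullback.lift y x h.symm ≫ add)
    (assoc : ∀ {T : 𝒞} (x y z : T ⟶ A) (h : x ≫ p = y ≫ p) (h' : y ≫ p = z ≫ p),
      pullback.lift (pullback.lift x y h ≫ add) z (by rw [Category.assoc, hadd, pullback.lift_fst_assoc, h, h']) ≫ add =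
      pullback.lift x (pullback.lift y z h' ≫ add) (by rw [Category.assoc, hadd, pullback.lift_fst_assoc, h]) ≫ add) :
    IsBeckModule p s := by
  have eta : ∀ {T : 𝒞} (t : T ⟶ pullback p p), t ≫ add =
      pullback.lift (t ≫ pullback.fst p p) (t ≫ pullback.snd p p)
        (by simp [pullback.condition]) ≫ add := by
    intro T t
    congr 1
    ext <;> simp
  refine ⟨{ one := Over.homMk s hs
            mul := Over.homMk add hadd
            inv := Over.homMk neg hneg
            one_mul := ?_
            mul_one := ?_
            mul_assoc := ?_
            left_inv := ?_
            right_inv := ?_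
            mul_comm := ?_ }, rfl⟩
  · apply Over.OverMorphism.ext
    refine (eta _).trans ?_
    have := zero_add (pullback.snd (𝟙 C) p)
    refine (Eq.trans ?_ this)
    congr 1
    apply pullback.hom_ext
    · refine (pullback.lift_fst _ _ _).trans ((Over.whiskerRight_left_fst (C := 𝒞) _).trans ?_)
      simp [← pullback.condition_assoc]
    · refine (pullback.lift_snd _ _ _).trans ((Over.whiskerRight_left_snd (C := 𝒞) _).trans ?_)
      simp
  · apply Over.OverMorphism.ext
    refine (eta _).trans ?_
    rw [comm]
    have := zero_add (pullback.fst p (𝟙 C))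
    refine (Eq.trans ?_ this)
    congr 1
    apply pullback.hom_ext
    · refine (pullback.lift_fst _ _ _).trans ((Over.whiskerLeft_left_snd (C := 𝒞) _).trans ?_)
      simp [pullback.condition_assoc]
    · refine (pullback.lift_snd _ _ _).trans ((Over.whiskerLeft_left_fst (C := 𝒞) _).trans ?_)
      simp
  · rw [← Category.assoc]
    apply Over.OverMorphism.ext
    let asc := MonoidalCategoryStruct.associator (Over.mk p) (Over.mk p) (Over.mk p)
    have := assoc (pullback.fst (pullback.fst p p ≫ p) p ≫ pullback.fst p p)
      (pullback.fst (pullback.fst p p ≫ p) p ≫ pullback.snd p p)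
      (pullback.snd (pullback.fst p p ≫ p) p) (by simp [pullback.condition])
      (by simp [← pullback.condition])
    refine (eta _).trans (Eq.trans (Eq.trans ?_ this) (Eq.trans ?_ (eta
      ((asc.hom ≫
        MonoidalCategoryStruct.whiskerLeft (Over.mk p)
          (Over.homMk add hadd : Over.mk (pullback.fst p p ≫ p) ⟶ Over.mk p)).left)).symm))
    · congr 1
      apply pullback.hom_ext
      · refine (pullback.lift_fst _ _ _).trans ((Over.whiskerRight_left_fst (C := 𝒞) _).trans
          ((eta _).trans (pullback.lift_fst _ _ _).symm))
      · refine (pullback.lift_snd _ _ _).trans ((Over.whiskerRight_left_snd (C := 𝒞) _).trans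
          (pullback.lift_snd _ _ _).symm)
    · congr 1
      apply pullback.hom_ext
      · refine (pullback.lift_fst _ _ _).trans (Eq.trans ?_ (pullback.lift_fst _ _ _).symm)
        refine Eq.trans ?_ (Category.assoc _ _ _).symm
        exact ((congrArg (fun z => asc.hom.left ≫ z) (Over.whiskerLeft_left_fst (R := Over.mk p)
          (Over.homMk add hadd : Over.mk (pullback.fst p p ≫ p) ⟶ Over.mk p))).trans
          (Over.associator_hom_left_fst (Over.mk p) (Over.mk p) (Over.mk p))).symm
      · refine (pullback.lift_snd _ _ _).trans (Eq.trans ?_ (pullback.lift_snd _ _ _).symm)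
        refine Eq.trans ?_ (Category.assoc _ _ _).symm
        refine Eq.trans ?_ (congrArg (fun z => asc.hom.left ≫ z)
          (Over.whiskerLeft_left_snd (R := Over.mk p)
          (Over.homMk add hadd : Over.mk (pullback.fst p p ≫ p) ⟶ Over.mk p))).symm
        refine Eq.trans ?_ (Category.assoc _ _ _)
        refine Eq.trans ?_ (eta _).symm
        congr 1
        apply pullback.hom_ext
        · exact (pullback.lift_fst _ _ _).trans (Eq.trans ((Category.assoc _ _ _).trans
              (Over.associator_hom_left_snd_fst (Over.mk p) (Over.mk p) (Over.mk p))).symm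
            (pullback.lift_fst _ _ _).symm)
        · exact (pullback.lift_snd _ _ _).trans (Eq.trans ((Category.assoc _ _ _).trans
              (Over.associator_hom_left_snd_snd (Over.mk p) (Over.mk p) (Over.mk p))).symm
            (pullback.lift_snd _ _ _).symm)
  · apply Over.OverMorphism.ext
    simpa using neg_add
  · apply Over.OverMorphism.ext
    have := neg_add
    rw [comm] at this
    simpa using this
  · apply Over.OverMorphism.ext
    refine (eta _).trans ?_
    rw [comm]
    refine Eq.trans ?_ (Category.id_comp add)
    congr 1
    apply pullback.hom_ext <;> simp

theorem AbAction.exists_of_point {A C B : 𝒞} {p : A ⟶ C} {s : C ⟶ A} {k : B ⟶ A}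
    (h : IsBeckModule p s) (hk : IsKer k p) : ∃ ξ : AbAction C B, IsConjugation ξ.act s k := by
  have hm := hk.mono
  have hs := h.section_comp
  obtain ⟨a, ha⟩ := hk.exists_lift (flatι C B ≫ coprod.desc s k) (by
    have : coprod.desc s k ≫ p = coprod.desc (𝟙 C) 0 := by ext <;> simp [hs, hk.1]
    rw [Category.assoc, this, flatι_desc])
  refine ⟨⟨⟨a, ?_, ?_⟩, A, p, s, k, h, hk, ha⟩, ha⟩
  · rw [← cancel_mono k, Category.assoc, ha, ← Category.assoc]; simp
  · have h1 : coprod.map (𝟙 C) a ≫ coprod.desc s k = coprod.desc s (a ≫ k) := by simp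
    have h2 : coprod.desc coprod.inl (flatι C B) ≫ coprod.desc s k = coprod.desc s (a ≫ k) := by
      ext <;> simp [ha]
    rw [← cancel_mono k, Category.assoc, Category.assoc, ha, ← Category.assoc, ← Category.assoc,
      flatμ_ι, flatMap_ι, Category.assoc, Category.assoc, h1, h2]

theorem IsBeckModule.baseChange {A C C' : 𝒞} {p : A ⟶ C'} {s : C' ⟶ A} (h : IsBeckModule p s)
    (g : C ⟶ C') : IsBeckModule (pullback.snd p g)
      (pullback.lift (g ≫ s) (𝟙 C) (by simp [h.section_comp])) := by
  obtain ⟨i, rfl⟩ := h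
  let := i
  refine ⟨{ Over.grpObjMkPullbackSnd (f := p) (g := g), 
     Over.isCommMonObj_mk_pullbackSnd (f := p) (g := g) with }, ?_⟩
  change (Over.monObjMkPullbackSnd (f := p) (g := g)).one.left = _
  rw [Over.monObjMkPullbackSnd_one]
  apply pullback.hom_ext <;> simp

/-- The action `g^*ξ` of `C` on `B` obtained from an action `ξ` of `C'` on `B` by restriction
along `g : C ⟶ C'`. -/
def AbAction.restrict {C C' B : 𝒞} (ξ : AbAction C' B) (g : C ⟶ C') : AbAction C B where
  act := flatMap g (𝟙 B) ≫ ξ.act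
  unit := by
    have : flatη C B ≫ flatMap g (𝟙 B) = flatη C' B := by
      rw [← cancel_mono (flatι _ _), Category.assoc, flatMap_ι, ← Category.assoc]; simp
    rw [← Category.assoc, this, ξ.unit]
  assoc := by
    have : flatμ C B ≫ flatMap g (𝟙 B) = flatMap g (flatMap g (𝟙 B)) ≫ flatμ C' B := by
      rw [← cancel_mono (flatι _ _)]
      simp only [Category.assoc, flatμ_ι, flatMap_ι]
      simp only [← Category.assoc, flatμ_ι, flatMap_ι]
      simp only [Category.assoc]
      congr 1
      ext <;> simp
    have h2 : flatMap (𝟙 C) (flatMap g (𝟙 B) ≫ ξ.act) ≫ flatMap g (𝟙 B) =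
        flatMap g (flatMap g (𝟙 B)) ≫ flatMap (𝟙 C') ξ.act := by
      rw [← cancel_mono (flatι _ _)]
      simp only [Category.assoc, flatMap_ι]
      simp only [← Category.assoc, flatMap_ι]
      simp
    rw [← Category.assoc, this, ← Category.assoc, h2, Category.assoc, Category.assoc, ξ.assoc]
  beck := by
    obtain ⟨A, p, s, k, hb, hk, hc⟩ := ξ.beck
    have := hk.mono
    refine ⟨_, _, _, pullback.lift k 0 (by simp [hk.1]), hb.baseChange g, ?_, ?_⟩
    · refine IsKer.of_lift (by simp) ?_ ?_
      · refine ⟨fun u v h => ?_⟩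
        have := congr($h ≫ pullback.fst _ _)
        simpa [cancel_mono] using this
      · intro T x hx
        obtain ⟨y, hy⟩ := hk.exists_lift (x ≫ pullback.fst _ _) (by
          rw [Category.assoc, pullback.condition, ← Category.assoc, hx, zero_comp])
        refine ⟨y, ?_⟩
        apply pullback.hom_ext <;> simp [hy, hx]
    · apply pullback.hom_ext
      · have h1 : coprod.map g (𝟙 B) ≫ coprod.desc s k = coprod.desc (g ≫ s) k := by simp
        simp only [Category.assoc, pullback.lift_fst]
        rw [show ξ.act ≫ k = _ from hc, ← Category.assoc, flatMap_ι, Category.assoc, h1]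
        congr 1
        ext <;> simp
      · simp only [Category.assoc, pullback.lift_snd, comp_zero]
        rw [← flatι_desc C B]
        congr 1
        ext <;> simp

/-! ### Abelian extensions -/

/-- The generalized element `(x, y, z)` of `E ×_C E ×_C E`. -/
def triple {E C T : 𝒞} {f : E ⟶ C} (x y z : T ⟶ E) (h : x ≫ f = y ≫ f) (h' : y ≫ f = z ≫ f) :
    T ⟶ pullback (pullback.snd f f) (pullback.fst f f) :=
  pullback.lift (pullback.lift x y h) (pullback.lift y z h') (by simp)

/-- An autonomous (i.e. associative and commutative) internal Mal'tsev operation on the object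
`f : E ⟶ C` of the slice category over `C`. -/
structure MaltsevOp {E C : 𝒞} (f : E ⟶ C) where
  op : pullback (pullback.snd f f) (pullback.fst f f) ⟶ E
  op_comp : op ≫ f = pullback.fst _ _ ≫ pullback.fst f f ≫ f
  left : ∀ {T : 𝒞} (x y : T ⟶ E) (h : x ≫ f = y ≫ f), triple x x y rfl h ≫ op = y
  right : ∀ {T : 𝒞} (x y : T ⟶ E) (h : x ≫ f = y ≫ f), triple x y y h rfl ≫ op = x
  assoc : ∀ {T : 𝒞} (x y z u w : T ⟶ E) (hxy : x ≫ f = y ≫ f) (hyz : y ≫ f = z ≫ f)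
    (hzu : z ≫ f = u ≫ f) (huw : u ≫ f = w ≫ f)
    (h : (triple x y z hxy hyz ≫ op) ≫ f = u ≫ f) (h' : y ≫ f = (triple z u w hzu huw ≫ op) ≫ f),
    triple (triple x y z hxy hyz ≫ op) u w h huw ≫ op =
      triple x y (triple z u w hzu huw ≫ op) hxy h' ≫ op
  comm : ∀ {T : 𝒞} (x y z : T ⟶ E) (hxy : x ≫ f = y ≫ f) (hyz : y ≫ f = z ≫ f),
    triple x y z hxy hyz ≫ op = triple z y x hyz.symm hxy.symm ≫ op

/-- An abelian extension `0 ⟶ B ⟶ E ⟶ C ⟶ 0`: `f` is a regular epimorphism with kernel `k`, and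
`f` carries an autonomous Mal'tsev operation in the slice category over `C`. -/
structure AbExt (C B : 𝒞) where
  E : 𝒞
  k : B ⟶ E
  f : E ⟶ C
  ker : IsKer k f
  regEpi : IsRegularEpi f
  abelian : Nonempty (MaltsevOp f)

/-- The abelian extension `X` of `C` by `B` induces the action `ξ` of `C` on `B`: composing `ξ`
with `f ♭ 1 : E ♭ B ⟶ C ♭ B` gives the conjugation action of `E` on its normal subobject `B`. -/
def AbExt.Induces {C B : 𝒞} (X : AbExt C B) (ξ : AbAction C B) : Prop :=
  flatMap X.f (𝟙 B) ≫ ξ.act ≫ X.k = flatι X.E B ≫ coprod.desc (𝟙 X.E) X.k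

theorem triple_proj₁₂ {E C : 𝒞} (f : E ⟶ C) :
    (pullback.fst (pullback.snd f f) (pullback.fst f f) ≫ pullback.fst f f) ≫ f =
      (pullback.fst (pullback.snd f f) (pullback.fst f f) ≫ pullback.snd f f) ≫ f := by
  rw [Category.assoc, pullback.condition (f := f), Category.assoc]

theorem triple_proj₂₃ {E C : 𝒞} (f : E ⟶ C) :
    (pullback.fst (pullback.snd f f) (pullback.fst f f) ≫ pullback.snd f f) ≫ f =
      (pullback.snd (pullback.snd f f) (pullback.fst f f) ≫ pullback.snd f f) ≫ f := by
  rw [pullback.condition, Category.assoc, pullback.condition (f := f), Category.assoc]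

section Maltsev

open scoped MonObj

variable {E C : 𝒞} {f : E ⟶ C} (M : MaltsevOp f)

theorem comp_triple {T S : 𝒞} (t : S ⟶ T) (x y z : T ⟶ E) (h : x ≫ f = y ≫ f)
    (h' : y ≫ f = z ≫ f) :
    t ≫ triple x y z h h' = triple (t ≫ x) (t ≫ y) (t ≫ z) (by simp [h]) (by simp [h']) := by
  apply pullback.hom_ext <;> apply pullback.hom_ext <;> simp [triple]

/-- The value of a Mal'tsev operation at the generalized element `(x, y, z)`. -/
def MaltsevOp.ap {T : 𝒞} (x y z : T ⟶ E) (h : x ≫ f = y ≫ f) (h' : y ≫ f = z ≫ f) : T ⟶ E :=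
  triple x y z h h' ≫ M.op

theorem MaltsevOp.ap_f {T : 𝒞} (x y z : T ⟶ E) (h : x ≫ f = y ≫ f) (h' : y ≫ f = z ≫ f) :
    M.ap x y z h h' ≫ f = x ≫ f := by
  simp [ap, M.op_comp, triple]

theorem MaltsevOp.comp_ap {T S : 𝒞} (t : S ⟶ T) (x y z : T ⟶ E) (h : x ≫ f = y ≫ f)
    (h' : y ≫ f = z ≫ f) :
    t ≫ M.ap x y z h h' = M.ap (t ≫ x) (t ≫ y) (t ≫ z) (by simp [h]) (by simp [h']) := by
  rw [ap, ap, ← comp_triple, Category.assoc]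

theorem MaltsevOp.ap_left {T : 𝒞} (x y : T ⟶ E) (h : x ≫ f = y ≫ f) : M.ap x x y rfl h = y :=
  M.left x y h

theorem MaltsevOp.ap_right {T : 𝒞} (x y : T ⟶ E) (h : x ≫ f = y ≫ f) : M.ap x y y h rfl = x :=
  M.right x y h

theorem MaltsevOp.ap_assoc {T : 𝒞} (x y z u w : T ⟶ E) (hxy : x ≫ f = y ≫ f)
    (hyz : y ≫ f = z ≫ f) (hzu : z ≫ f = u ≫ f) (huw : u ≫ f = w ≫ f) :
    M.ap (M.ap x y z hxy hyz) u w (by rw [ap_f, hxy, hyz, hzu]) huw =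
      M.ap x y (M.ap z u w hzu huw) hxy (by rw [ap_f, hyz]) :=
  M.assoc x y z u w hxy hyz hzu huw _ _

theorem MaltsevOp.ap_comm {T : 𝒞} (x y z : T ⟶ E) (hxy : x ≫ f = y ≫ f) (hyz : y ≫ f = z ≫ f) :
    M.ap x y z hxy hyz = M.ap z y x hyz.symm hxy.symm :=
  M.comm x y z hxy hyz

theorem MaltsevOp.exists_pullback (M : MaltsevOp f) {C' : 𝒞} (g : C' ⟶ C) :
    Nonempty (MaltsevOp (pullback.snd f g)) := by
  have e {T : 𝒞} (x y : T ⟶ pullback f g)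
      (h : x ≫ pullback.snd f g = y ≫ pullback.snd f g) :
      (x ≫ pullback.fst f g) ≫ f = (y ≫ pullback.fst f g) ≫ f := by
    rw [Category.assoc, Category.assoc, pullback.condition, ← Category.assoc, h, Category.assoc]
  let P := pullback (pullback.snd (pullback.snd f g) (pullback.snd f g))
    (pullback.fst (pullback.snd f g) (pullback.snd f g))
  let x : P ⟶ pullback f g := pullback.fst _ _ ≫ pullback.fst _ _
  let y : P ⟶ pullback f g := pullback.fst _ _ ≫ pullback.snd _ _
  let z : P ⟶ pullback f g := pullback.snd _ _ ≫ pullback.snd _ _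
  have hxy : x ≫ pullback.snd f g = y ≫ pullback.snd f g := triple_proj₁₂ _
  have hyz : y ≫ pullback.snd f g = z ≫ pullback.snd f g := triple_proj₂₃ _
  let o : P ⟶ pullback f g := pullback.lift (M.ap (x ≫ pullback.fst f g)
    (y ≫ pullback.fst f g) (z ≫ pullback.fst f g) (e _ _ hxy) (e _ _ hyz))
    (x ≫ pullback.snd f g) (by
      rw [M.ap_f, Category.assoc x, Category.assoc x, pullback.condition])
  have key {T : 𝒞} (a b c : T ⟶ pullback f g)
      (h : a ≫ pullback.snd f g = b ≫ pullback.snd f g)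
      (h' : b ≫ pullback.snd f g = c ≫ pullback.snd f g) :
      triple a b c h h' ≫ o = pullback.lift (M.ap (a ≫ pullback.fst f g)
        (b ≫ pullback.fst f g) (c ≫ pullback.fst f g) (e _ _ h) (e _ _ h'))
        (a ≫ pullback.snd f g) (by rw [M.ap_f, Category.assoc, Category.assoc,
          pullback.condition]) := by
    apply pullback.hom_ext
    · simp [o, M.comp_ap, x, y, z, triple]
    · simp [o, x, triple]
  refine ⟨⟨o, ?_, ?_, ?_, ?_, ?_⟩⟩
  · simp only [o, x, pullback.lift_snd, Category.assoc]
  · intro T a b h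
    rw [key]
    apply pullback.hom_ext
    · simp [M.ap_left]
    · simp [h]
  · intro T a b h
    rw [key]
    apply pullback.hom_ext
    · simp [M.ap_right]
    · simp
  · intro T a b c d w _ _ _ _ _ _
    apply pullback.hom_ext
    · simp only [key, pullback.lift_fst]
      exact M.ap_assoc _ _ _ _ _ _ _ _ _
    · simp only [key, pullback.lift_snd]
  · intro T a b c h h'
    rw [key, key]
    apply pullback.hom_ext
    · simp only [pullback.lift_fst]
      rw [M.ap_comm]
    · simp [h, h']

theorem IsBeckModule.maltsev {A : 𝒞} {p : A ⟶ C} {s : C ⟶ A} (h : IsBeckModule p s) :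
    Nonempty (MaltsevOp p) := by
  obtain ⟨i, rfl⟩ := h
  let := i
  let X := Over.mk p
  let P := pullback (pullback.snd p p) (pullback.fst p p)
  let π : P ⟶ C := pullback.fst _ _ ≫ pullback.fst _ _ ≫ p
  let x : Over.mk π ⟶ X := Over.homMk (pullback.fst _ _ ≫ pullback.fst _ _) (by simp [π, X])
  let y : Over.mk π ⟶ X := Over.homMk (pullback.fst _ _ ≫ pullback.snd _ _)
    ((triple_proj₁₂ p).symm.trans (Category.assoc _ _ _))
  let z : Over.mk π ⟶ X := Over.homMk (pullback.snd _ _ ≫ pullback.snd _ _)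
    (((triple_proj₁₂ p).trans (triple_proj₂₃ p)).symm.trans (Category.assoc _ _ _))
  have key {T : 𝒞} (a b c : T ⟶ A) (h : a ≫ p = b ≫ p) (h' : b ≫ p = c ≫ p) :
      triple a b c h h' ≫ (x * y⁻¹ * z).left =
        ((Over.homMk a : Over.mk (a ≫ p) ⟶ X) * (Over.homMk b h.symm : Over.mk (a ≫ p) ⟶ X)⁻¹ *
          (Over.homMk c (h.trans h').symm : Over.mk (a ≫ p) ⟶ X)).left := by
    let t : Over.mk (a ≫ p) ⟶ Over.mk π := Over.homMk (triple a b c h h') (by simp [triple, π])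
    have hx : t ≫ x = Over.homMk a := by ext; simp [t, x, triple]
    have hy : t ≫ y = Over.homMk b h.symm := by ext; simp [t, y, triple]
    have hz : t ≫ z = Over.homMk c (h.trans h').symm := by ext; simp [t, z, triple]
    rw [← hx, ← hy, ← hz, ← GrpObj.comp_inv, ← MonObj.comp_mul, ← MonObj.comp_mul]
    rfl
  have cg {T : 𝒞} {t t' : T ⟶ C} (ht : t = t') (a b c : T ⟶ A) (ha : a ≫ p = t)
      (hb : b ≫ p = t) (hc : c ≫ p = t) :
      ((Over.homMk a ha : Over.mk t ⟶ X) * (Over.homMk b hb : Over.mk t ⟶ X)⁻¹ *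
          (Over.homMk c hc : Over.mk t ⟶ X)).left =
      ((Over.homMk a (ha.trans ht) : Over.mk t' ⟶ X) *
        (Over.homMk b (hb.trans ht) : Over.mk t' ⟶ X)⁻¹ *
          (Over.homMk c (hc.trans ht) : Over.mk t' ⟶ X)).left := by
    subst ht; rfl
  refine ⟨⟨(x * y⁻¹ * z).left, ?_, ?_, ?_, ?_, ?_⟩⟩
  · exact Over.w (x * y⁻¹ * z)
  · intro T a b h
    rw [key]; simp
  · intro T a b h
    rw [key]; simp
  · intro T a b c d w hab hbc hcd hdw h h'
    have hA : (triple a b c hab hbc ≫ (x * y⁻¹ * z).left) ≫ p = a ≫ p :=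
      h.trans (hab.trans (hbc.trans hcd)).symm
    have e1 : (Over.homMk (triple a b c hab hbc ≫ (x * y⁻¹ * z).left) hA :
        Over.mk (a ≫ p) ⟶ X) = Over.homMk a * (Over.homMk b hab.symm)⁻¹ *
          Over.homMk c (hab.trans hbc).symm := Over.OverMorphism.ext (key _ _ _ _ _)
    have e2 : (Over.homMk (triple c d w hcd hdw ≫ (x * y⁻¹ * z).left) (h'.symm.trans hab.symm) :
        Over.mk (a ≫ p) ⟶ X) = Over.homMk c (hab.trans hbc).symm *
          (Over.homMk d (hab.trans (hbc.trans hcd)).symm)⁻¹ *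
          Over.homMk w (hab.trans (hbc.trans (hcd.trans hdw))).symm :=
      Over.OverMorphism.ext ((key _ _ _ _ _).trans (cg (hab.trans hbc).symm _ _ _ _ _ _))
    refine ((key _ _ _ _ _).trans (cg hA _ _ _ _ _ _)).trans (Eq.trans ?_ (key _ _ _ _ _).symm)
    rw [e1, e2]
    simp only [mul_assoc]
  · intro T a b c h h'
    rw [key, key, cg (h.trans h')]
    congr 1
    rw [mul_comm, ← mul_assoc, mul_right_comm]

end Maltsev

/-! ### The induced action -/

section Direction

theorem MaltsevOp.exists_quotient {E C : 𝒞} {f : E ⟶ C} (M : MaltsevOp f) :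
    ∃ (A : 𝒞) (a : A ⟶ C) (q : pullback f f ⟶ A),
      q ≫ a = pullback.fst f f ≫ f ∧
      (∀ {T : 𝒞} (e x e' : T ⟶ E) (h : e ≫ f = x ≫ f) (h' : e' ≫ f = e ≫ f),
        pullback.lift e x h ≫ q = pullback.lift e' (M.ap e' e x h' h) (by rw [M.ap_f]) ≫ q) ∧
      (∀ {T : 𝒞} (e x y : T ⟶ E) (h : e ≫ f = x ≫ f) (h' : e ≫ f = y ≫ f),
        pullback.lift e x h ≫ q = pullback.lift e y h' ≫ q → x = y) ∧
      (∀ {T : 𝒞} (α : T ⟶ A) (e : T ⟶ E), α ≫ a = e ≫ f →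
        ∃ (x : T ⟶ E) (h : e ≫ f = x ≫ f), pullback.lift e x h ≫ q = α) := by
  -- the relation on `R = E ×_C E` identifying `(e, x)` with `(e', e' - e + x)`
  let R := pullback f f
  let W := pullback (pullback.fst f f ≫ f) f
  let we {T : 𝒞} (t : T ⟶ W) : T ⟶ E := t ≫ pullback.fst _ _ ≫ pullback.fst _ _
  let wx {T : 𝒞} (t : T ⟶ W) : T ⟶ E := t ≫ pullback.fst _ _ ≫ pullback.snd _ _
  let we' {T : 𝒞} (t : T ⟶ W) : T ⟶ E := t ≫ pullback.snd _ _
  have hw1 {T : 𝒞} (t : T ⟶ W) : we t ≫ f = wx t ≫ f := by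
    simp only [we, wx, Category.assoc, pullback.condition (f := f)]
  have hw2 {T : 𝒞} (t : T ⟶ W) : we' t ≫ f = we t ≫ f := by
    simp only [we, we', Category.assoc, ← pullback.condition (f := pullback.fst f f ≫ f)]
  let w1 : W ⟶ R := pullback.fst _ _
  let w2 : W ⟶ R := pullback.lift (we' (𝟙 W)) (M.ap (we' (𝟙 W)) (we (𝟙 W)) (wx (𝟙 W)) (hw2 _)
    (hw1 _)) (by rw [M.ap_f])
  let wk {T : 𝒞} (e x e' : T ⟶ E) (h : e ≫ f = x ≫ f) (h' : e' ≫ f = e ≫ f) : T ⟶ W :=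
    pullback.lift (pullback.lift e x h) e' (by simp [h'])
  have wk1 {T : 𝒞} (e x e' : T ⟶ E) (h : e ≫ f = x ≫ f) (h' : e' ≫ f = e ≫ f) :
      wk e x e' h h' ≫ w1 = pullback.lift e x h := by simp [wk, w1]
  have wk2 {T : 𝒞} (e x e' : T ⟶ E) (h : e ≫ f = x ≫ f) (h' : e' ≫ f = e ≫ f) :
      wk e x e' h h' ≫ w2 = pullback.lift e' (M.ap e' e x h' h) (by rw [M.ap_f]) := by
    apply pullback.hom_ext
    · simp [wk, w2, we']
    · simp [wk, w2, we', we, wx, M.comp_ap]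
  have wext {T : 𝒞} (t : T ⟶ W) : t = wk (we t) (wx t) (we' t) (hw1 t) (hw2 t) := by
    apply pullback.hom_ext
    · apply pullback.hom_ext <;> simp [wk, we, wx]
    · simp [wk, we']
  have hR {T : 𝒞} (r : T ⟶ R) : (r ≫ pullback.fst f f) ≫ f = (r ≫ pullback.snd f f) ≫ f := by
    simp [pullback.condition]
  have hRe {T : 𝒞} (r : T ⟶ R) : r = pullback.lift (r ≫ pullback.fst f f) (r ≫ pullback.snd f f)
      (hR r) := by
    apply pullback.hom_ext <;> simp
  have w1e {T : 𝒞} (t : T ⟶ W) : t ≫ w1 = pullback.lift (we t) (wx t) (hw1 t) := by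
    conv_lhs => rw [wext t]
    exact wk1 _ _ _ _ (hw2 t)
  have w2e {T : 𝒞} (t : T ⟶ W) : t ≫ w2 = pullback.lift (we' t)
      (M.ap (we' t) (we t) (wx t) (hw2 t) (hw1 t)) (by rw [M.ap_f]) := by
    conv_lhs => rw [wext t]
    exact wk2 _ _ _ _ _
  have hab {T : 𝒞} {a b c d : T ⟶ E} {h h'} (h0 : pullback.lift a b h =
      (pullback.lift c d h' : T ⟶ R)) : a = c ∧ b = d :=
    ⟨by simpa [R] using congr($h0 ≫ pullback.fst f f),
      by simpa [R] using congr($h0 ≫ pullback.snd f f)⟩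
  have hE : IsEquivalenceRelation w1 w2 := by
    have hc : we' (pullback.fst w2 w1) = we (pullback.snd w2 w1) ∧
        M.ap (we' (pullback.fst w2 w1)) (we (pullback.fst w2 w1)) (wx (pullback.fst w2 w1))
          (hw2 _) (hw1 _) = wx (pullback.snd w2 w1) := by
      have := pullback.condition (f := w2) (g := w1)
      rw [w1e, w2e] at this
      exact hab this
    have id1 : 𝟙 R = pullback.lift (pullback.fst f f) (pullback.snd f f) pullback.condition := by
      apply pullback.hom_ext
      · rw [pullback.lift_fst]; exact Category.id_comp _
      · rw [pullback.lift_snd]; exact Category.id_comp _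
    have h3 : we' (pullback.snd w2 w1) ≫ f = we (pullback.fst w2 w1) ≫ f := by
      rw [hw2, ← hc.1, hw2]
    refine ⟨⟨{ right_cancellation := ?_
               r := wk (pullback.fst f f) (pullback.snd f f) (pullback.fst f f)
                pullback.condition rfl
               reflexivity₁ := ?_
               reflexivity₂ := ?_
               s := wk (we' (𝟙 W)) (M.ap (we' (𝟙 W)) (we (𝟙 W)) (wx (𝟙 W)) (hw2 _) (hw1 _))
                (we (𝟙 W)) (by rw [M.ap_f]) (hw2 _).symm
               symmetry₁ := ?_
               symmetry₂ := ?_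
               c := pullback.cone w2 w1
               isLimit := pullback.isLimit w2 w1
               t := wk (we (pullback.fst w2 w1)) (wx (pullback.fst w2 w1))
                (we' (pullback.snd w2 w1)) (hw1 _) h3
               transitivity₁ := ?_
               transitivity₂ := ?_ }⟩⟩
    · intro T a b h1 h2
      rw [w1e, w1e] at h1
      rw [w2e, w2e] at h2
      rw [wext a, wext b]
      simp only [(hab h1).1, (hab h1).2, (hab h2).1]
    · exact (wk1 _ _ _ _ rfl).trans id1.symm
    · refine (wk2 _ _ _ _ rfl).trans (Eq.trans ?_ id1.symm)
      simp only [M.ap_left]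
    · exact (wk1 _ _ _ _ (hw2 _).symm).trans ((w2e _).symm.trans (Category.id_comp _))
    · refine (wk2 _ _ _ _ (hw2 _).symm).trans ?_
      refine Eq.trans ?_ ((w1e (𝟙 W)).symm.trans (Category.id_comp _))
      congr 1
      rw [← M.ap_assoc _ _ _ _ _ (hw2 _).symm rfl (hw2 _) (hw1 _)]
      simp only [M.ap_right, M.ap_left]
    · exact (wk1 _ _ _ _ h3).trans (w1e _).symm
    · refine (wk2 _ _ _ _ h3).trans ?_
      refine Eq.trans ?_ (w2e _).symm
      have hl {T : 𝒞} {e x x' : T ⟶ E} (h : e ≫ f = x ≫ f) (h' : e ≫ f = x' ≫ f) (H : x = x') :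
          (pullback.lift e x h : T ⟶ R) = pullback.lift e x' h' := by subst H; rfl
      have hm {T : 𝒞} {e b b' c c' : T ⟶ E} (h : e ≫ f = b ≫ f) (h' : b ≫ f = c ≫ f)
          (H : b = b') (H' : c = c') : M.ap e b' c' (H ▸ h) (H ▸ H' ▸ h') = M.ap e b c h h' := by
        subst H; subst H'; rfl
      refine hl _ _ (Eq.trans ?_ (hm (by rw [hc.1, hw2]; rfl) (by rw [M.ap_f]) hc.1 hc.2).symm)
      rw [← M.ap_assoc _ _ _ _ _ _ rfl (hw2 _) (hw1 _)]
      simp only [M.ap_right]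
      rfl
  obtain ⟨⟨eff⟩⟩ := SemiAbelian.effective w1 w2 hE
  let q := eff.π
  have hq : IsRegularEpi q := ⟨⟨⟨W, w1, w2, eff.isPushout.w, by
    exact Cofork.IsColimit.mk' _ fun s => ⟨eff.isPushout.desc s.π s.π s.condition,
      eff.isPushout.inl_desc _ _ _, fun {m} hm => eff.isPushout.hom_ext
        (hm.trans (eff.isPushout.inl_desc _ _ _).symm)
        (hm.trans (eff.isPushout.inl_desc _ _ _).symm)⟩⟩⟩⟩
  have hq' : w1 ≫ q = w2 ≫ q := eff.isPushout.w
  have ha : w1 ≫ pullback.fst f f ≫ f = w2 ≫ pullback.fst f f ≫ f := by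
    have e1 := w1e (𝟙 W)
    have e2 := w2e (𝟙 W)
    rw [Category.id_comp] at e1 e2
    rw [e1, e2, pullback.lift_fst_assoc, pullback.lift_fst_assoc, hw2]
  let a : eff.B ⟶ C := eff.isPushout.desc (pullback.fst f f ≫ f) (pullback.fst f f ≫ f) ha
  have hqa : q ≫ a = pullback.fst f f ≫ f := eff.isPushout.inl_desc _ _ _
  have inj {T : 𝒞} (e x y : T ⟶ E) (h : e ≫ f = x ≫ f) (h' : e ≫ f = y ≫ f)
      (H : pullback.lift e x h ≫ q = pullback.lift e y h' ≫ q) : x = y := by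
    obtain ⟨t, ht1, ht2⟩ := IsPullback.exists_lift eff.isKernelPair _ _ H
    rw [w1e] at ht1
    rw [w2e] at ht2
    obtain ⟨h1, h2⟩ := hab ht1
    obtain ⟨h3, h4⟩ := hab ht2
    rw [← h4, ← h2]
    simp only [h3, h1, M.ap_left]
  refine ⟨eff.B, a, q, hqa, ?_, inj, ?_⟩
  · intro T e x e' h h'
    rw [← wk1 e x e' h h', ← wk2 e x e' h h', Category.assoc, hq', Category.assoc]
  · intro T α e hα
    let p : pullback α q ⟶ T := pullback.fst α q
    have hp : IsRegularEpi p := inferInstance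
    let r : pullback α q ⟶ R := pullback.snd α q
    have hpr : p ≫ α = r ≫ q := pullback.condition
    have h1 : (p ≫ e) ≫ f = (r ≫ pullback.fst f f) ≫ f := by
      rw [Category.assoc, ← hα, reassoc_of% hpr, hqa, Category.assoc]
    let y := M.ap (p ≫ e) (r ≫ pullback.fst f f) (r ≫ pullback.snd f f) h1 (hR r)
    have hy : (p ≫ e) ≫ f = y ≫ f := by rw [M.ap_f]
    have hyq : pullback.lift (p ≫ e) y hy ≫ q = p ≫ α := by
      rw [hpr, hRe r, ← wk2 _ _ _ (hR r) h1, ← wk1 _ _ _ (hR r) h1, Category.assoc, Category.assoc,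
        hq']
    have hdesc : ∀ {Z : 𝒞} (g₁ g₂ : Z ⟶ pullback α q), g₁ ≫ p = g₂ ≫ p → g₁ ≫ y = g₂ ≫ y := by
      intro Z g₁ g₂ hg
      have c (g : Z ⟶ pullback α q) : pullback.lift (g ≫ p ≫ e) (g ≫ y)
          (by rw [Category.assoc, hy, Category.assoc]) ≫ q = g ≫ p ≫ α := by
        rw [← hyq]
        refine Eq.trans ?_ (Category.assoc _ _ _)
        congr 1
        apply pullback.hom_ext <;> simp
      have e1 := c g₁
      have e2 := c g₂
      simp only [reassoc_of% hg] at e1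
      exact inj _ _ _ _ _ (e1.trans e2.symm)
    have hx := EffectiveEpi.fac p y hdesc
    have hex : e ≫ f = EffectiveEpi.desc p y hdesc ≫ f := by
      rw [← cancel_epi p, reassoc_of% hx, ← hy, Category.assoc]
    refine ⟨EffectiveEpi.desc p y hdesc, hex, ?_⟩
    rw [← cancel_epi p, ← hyq, ← Category.assoc]
    congr 1
    apply pullback.hom_ext <;> simp [hx]

theorem exists_direction {C B : 𝒞} (X : AbExt C B) : ∃ ξ : AbAction C B, X.Induces ξ := by
  obtain ⟨E, k, f, hk, hf, ⟨M⟩⟩ := X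
  have hkm := hk.mono
  obtain ⟨A, a, q, hqa, qeq, inj, surj⟩ := M.exists_quotient
  let Q {T : 𝒞} (e x : T ⟶ E) (h : e ≫ f = x ≫ f) : T ⟶ A := pullback.lift e x h ≫ q
  have Qa {T : 𝒞} (e x : T ⟶ E) (h : e ≫ f = x ≫ f) : Q e x h ≫ a = e ≫ f := by
    simp [Q, hqa]
  have Qc {T S : 𝒞} (t : S ⟶ T) (e x : T ⟶ E) (h : e ≫ f = x ≫ f) :
      t ≫ Q e x h = Q (t ≫ e) (t ≫ x) (by simp [h]) := by
    refine (Category.assoc _ _ _).symm.trans ?_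
    simp only [Q]
    congr 1
    apply pullback.hom_ext <;> simp
  have Qg {T : 𝒞} {e x e' x' : T ⟶ E} (h : e ≫ f = x ≫ f) (h' : e' ≫ f = x' ≫ f)
      (he : e = e') (hx : x = x') : Q e x h = Q e' x' h' := by subst he; subst hx; rfl
  have Qinj {T : 𝒞} {e x y : T ⟶ E} {h : e ≫ f = x ≫ f} {h' : e ≫ f = y ≫ f}
      (H : Q e x h = Q e y h') : x = y := inj _ _ _ h h' H
  have Qchg {T : 𝒞} {e x e' x' : T ⟶ E} {h : e ≫ f = x ≫ f} {h' : e' ≫ f = x' ≫ f}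
      (he : e' ≫ f = e ≫ f) (H : Q e x h = Q e' x' h') : x' = M.ap e' e x he h :=
    Qinj (h := h') (h' := by rw [M.ap_f]) (H.symm.trans (qeq _ _ _ h he))
  have Qsurj {T : 𝒞} (α : T ⟶ A) (e : T ⟶ E) (hα : α ≫ a = e ≫ f) :
    ∃ (x : T ⟶ E) (h : e ≫ f = x ≫ f), Q e x h = α := surj α e hα
  have Qqeq {T : 𝒞} (e x e' : T ⟶ E) (h : e ≫ f = x ≫ f) (h' : e' ≫ f = e ≫ f) :
    Q e x h = Q e' (M.ap e' e x h' h) (by rw [M.ap_f]) := qeq _ _ _ h h'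
  -- generalized elements of `A` are locally of the form `Q e x`
  have cover {T : 𝒞} (t : T ⟶ C) : ∃ (S : 𝒞) (p : S ⟶ T) (e : S ⟶ E), Epi p ∧ p ≫ t = e ≫ f :=
    ⟨pullback t f, pullback.fst _ _, pullback.snd _ _, inferInstance, pullback.condition⟩
  have fepi : Epi f := inferInstance
  -- the zero section
  have hs0 : ∀ {Z : 𝒞} (g₁ g₂ : Z ⟶ E), g₁ ≫ f = g₂ ≫ f →
      g₁ ≫ Q (𝟙 E) (𝟙 E) rfl = g₂ ≫ Q (𝟙 E) (𝟙 E) rfl := by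
    intro Z g₁ g₂ hg
    rw [Qc, Qc, Qqeq (g₁ ≫ 𝟙 E) _ (g₂ ≫ 𝟙 E) _ (by simp [hg])]
    exact Qg _ _ rfl (by rw [M.ap_right])
  let s : C ⟶ A := EffectiveEpi.desc f (Q (𝟙 E) (𝟙 E) rfl) hs0
  have hs : f ≫ s = Q (𝟙 E) (𝟙 E) rfl := EffectiveEpi.fac f _ hs0
  have hs' {T : 𝒞} (e : T ⟶ E) : e ≫ f ≫ s = Q e e rfl := by
    rw [hs, Qc]; exact Qg _ _ (by simp) (by simp)
  have hsa : s ≫ a = 𝟙 C := by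
    rw [← cancel_epi f, reassoc_of% hs, Qa]; simp
  -- the kernel of `a`
  have hkf : k ≫ f = 0 := hk.1
  let κ : B ⟶ A := Q 0 k (by simp [hkf])
  have hκ : IsKer κ a := by
    refine IsKer.of_lift (by simp [κ, Qa]) ⟨fun u v huv => ?_⟩ ?_
    · simp only [κ, Qc] at huv
      rw [← cancel_mono k]
      refine Qinj (e := 0) (h := by simp [hkf]) (h' := by simp [hkf]) ?_
      exact (Qg _ _ (by simp) rfl).trans (huv.trans (Qg _ _ (by simp) rfl))
    · intro T α hα
      obtain ⟨x, hx, hxα⟩ := Qsurj α 0 (by simp [hα])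
      obtain ⟨y, hy⟩ := hk.exists_lift x (by rw [← hx, zero_comp])
      refine ⟨y, ?_⟩
      rw [← hxα, Qc]
      exact Qg _ _ (by simp) hy
  -- the addition
  let P := pullback a a
  let t : P ⟶ C := pullback.fst a a ≫ a
  let S := pullback t f
  let p : S ⟶ P := pullback.fst t f
  have hp : IsRegularEpi p := inferInstance
  let ε : S ⟶ E := pullback.snd t f
  have hε : p ≫ t = ε ≫ f := pullback.condition
  obtain ⟨x, hx, hxq⟩ := Qsurj (p ≫ pullback.fst a a) ε (by rw [← hε, Category.assoc])
  obtain ⟨y, hy, hyq⟩ := Qsurj (p ≫ pullback.snd a a) ε (by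
    rw [← hε, Category.assoc, ← pullback.condition])
  have sum_chg {T : 𝒞} {e x y e' x' y' : T ⟶ E} {hx : e ≫ f = x ≫ f} {hx' : e' ≫ f = x' ≫ f}
      {hy : e ≫ f = y ≫ f} {hy' : e' ≫ f = y' ≫ f} (hX : Q e x hx = Q e' x' hx')
      (hY : Q e y hy = Q e' y' hy') :
      Q e (M.ap x e y hx.symm hy) (by rw [M.ap_f, hx]) =
        Q e' (M.ap x' e' y' hx'.symm hy') (by rw [M.ap_f, hx']) := by
    have he : e' ≫ f = e ≫ f := by rw [← Qa e x hx, hX, Qa]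
    rw [Qqeq _ _ e' _ he]
    refine Qg _ _ rfl ?_
    have h1 := Qchg he hX
    have h2 := Qchg he hY
    simp only [h1, h2]
    rw [← M.ap_assoc _ _ _ _ _ _ _ he hy]
    · simp only [M.ap_right]
      rw [M.ap_assoc _ _ _ _ _ he hx hx.symm hy]
    · rfl
  have hadd0 : ∀ {Z : 𝒞} (g₁ g₂ : Z ⟶ S), g₁ ≫ p = g₂ ≫ p →
      g₁ ≫ Q ε (M.ap x ε y hx.symm hy) (by rw [M.ap_f, hx]) =
        g₂ ≫ Q ε (M.ap x ε y hx.symm hy) (by rw [M.ap_f, hx]) := by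
    intro Z g₁ g₂ hg
    simp only [Qc, M.comp_ap]
    apply sum_chg
    · rw [← Qc, hxq, ← Qc, hxq, reassoc_of% hg] <;> exact hx
    · rw [← Qc, hyq, ← Qc, hyq, reassoc_of% hg] <;> exact hy
  let add : P ⟶ A := EffectiveEpi.desc p _ hadd0
  have hadd1 : p ≫ add = _ := EffectiveEpi.fac p _ hadd0
  have hadd {T : 𝒞} (e u w : T ⟶ E) (hu : e ≫ f = u ≫ f) (hw : e ≫ f = w ≫ f) :
      pullback.lift (Q e u hu) (Q e w hw) (by rw [Qa, Qa]) ≫ add =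
        Q e (M.ap u e w hu.symm hw) (by rw [M.ap_f, hu]) := by
    let l : T ⟶ P := pullback.lift (Q e u hu) (Q e w hw) (by rw [Qa, Qa])
    let m : T ⟶ S := pullback.lift l e (by simp [l, t, Qa])
    have hm : m ≫ p = l := pullback.lift_fst _ _ _
    change l ≫ add = _
    rw [← hm, Category.assoc, hadd1, Qc]
    simp only [M.comp_ap]
    apply sum_chg
    · rw [← Qc, hxq, ← Category.assoc, hm]
      · exact pullback.lift_fst _ _ _
      · exact hx
    · rw [← Qc, hyq, ← Category.assoc, hm]
      · exact pullback.lift_snd _ _ _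
      · exact hy
  -- the negation
  let V := pullback a f
  obtain ⟨z, hz, hzq⟩ := Qsurj (pullback.fst a f) (pullback.snd a f) pullback.condition
  have neg_chg {T : 𝒞} {e x e' x' : T ⟶ E} {hx : e ≫ f = x ≫ f} {hx' : e' ≫ f = x' ≫ f}
      (hX : Q e x hx = Q e' x' hx') : Q x e hx.symm = Q x' e' hx'.symm := by
    have he : e' ≫ f = e ≫ f := by rw [← Qa e x hx, hX, Qa]
    have h1 := Qchg he hX
    rw [Qqeq _ _ x' _ (by rw [← hx', he, hx])]
    refine Qg _ _ rfl ?_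
    simp only [h1]
    rw [M.ap_assoc _ _ _ _ _ he hx rfl hx.symm]
    simp only [M.ap_left, M.ap_right]
  have hneg0 : ∀ {Z : 𝒞} (g₁ g₂ : Z ⟶ V), g₁ ≫ pullback.fst a f = g₂ ≫ pullback.fst a f →
      g₁ ≫ Q z (pullback.snd a f) hz.symm = g₂ ≫ Q z (pullback.snd a f) hz.symm := by
    intro Z g₁ g₂ hg
    simp only [Qc]
    apply neg_chg
    rw [← Qc, hzq, ← Qc, hzq, hg] <;> exact hz
  let neg : A ⟶ A := EffectiveEpi.desc (pullback.fst a f) _ hneg0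
  have hneg1 : pullback.fst a f ≫ neg = _ := EffectiveEpi.fac (pullback.fst a f) _ hneg0
  have hneg {T : 𝒞} (e u : T ⟶ E) (hu : e ≫ f = u ≫ f) : Q e u hu ≫ neg = Q u e hu.symm := by
    let m : T ⟶ V := pullback.lift (Q e u hu) e (by rw [Qa])
    have hm : m ≫ pullback.fst a f = Q e u hu := pullback.lift_fst _ _ _
    have hm' : m ≫ pullback.snd a f = e := pullback.lift_snd _ _ _
    rw [← hm, Category.assoc, hneg1, Qc]
    apply neg_chg
    rw [← Qc, hzq, hm]
    exact hz
  have hb : IsBeckModule a s := by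
    have comp_lift {T S : 𝒞} (c : T ⟶ S) (u w : S ⟶ A) (h : u ≫ a = w ≫ a) :
        c ≫ pullback.lift u w h = pullback.lift (c ≫ u) (c ≫ w) (by simp [h]) := by
      apply pullback.hom_ext <;> simp
    have lift_congr {T : 𝒞} {u w u' w' : T ⟶ A} (h : u ≫ a = w ≫ a) (h' : u' ≫ a = w' ≫ a)
        (h1 : u = u') (h2 : w = w') : pullback.lift u w h ≫ add = pullback.lift u' w' h' ≫ add := by
      subst h1; subst h2; rfl
    have hP : add ≫ a = pullback.fst a a ≫ a := by
      have : Epi p := inferInstance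
      rw [← cancel_epi p, reassoc_of% hadd1, Qa, ← hε]
    have hN : neg ≫ a = a := by
      rw [← cancel_epi (pullback.fst a f), reassoc_of% hneg1, Qa, ← hz, pullback.condition]
    refine IsBeckModule.of_ops hsa add hP neg hN ?_ ?_ ?_ ?_
    · intro T α
      obtain ⟨S, c, e, hc, he⟩ := cover (α ≫ a)
      obtain ⟨u, hu, huq⟩ := Qsurj (c ≫ α) e (by rw [Category.assoc, he])
      rw [← cancel_epi c]
      refine (Category.assoc _ _ _).symm.trans ?_
      rw [comp_lift]
      refine Eq.trans ?_ huq
      refine (lift_congr _ (by rw [Qa, Qa]) ?_ huq.symm).trans ((hadd e e u rfl hu).trans ?_)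
      · rw [← hs', ← reassoc_of% he]
      · exact Qg _ _ rfl (M.ap_left _ _ _)
    · obtain ⟨S, c, e, hc, he⟩ := cover a
      obtain ⟨u, hu, huq⟩ := Qsurj c e he
      rw [← cancel_epi c, ← Category.assoc, comp_lift]
      have h1 : c ≫ neg = Q e (M.ap e u e hu hu.symm) (by rw [M.ap_f]) := by
        rw [← huq, hneg, Qqeq _ _ e _ hu]
      refine (lift_congr _ (by rw [Qa, Qa]) h1 ((Category.comp_id _).trans huq.symm)).trans
        ((hadd e _ u _ hu).trans ?_)
      rw [reassoc_of% he, hs']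
      refine Qg _ _ rfl ?_
      rw [M.ap_assoc _ _ _ _ _ hu hu.symm rfl hu]
      simp only [M.ap_left, M.ap_right]
    · intro T α β h
      obtain ⟨S, c, e, hc, he⟩ := cover (α ≫ a)
      obtain ⟨u, hu, huq⟩ := Qsurj (c ≫ α) e (by rw [Category.assoc, he])
      obtain ⟨w, hw, hwq⟩ := Qsurj (c ≫ β) e (by rw [Category.assoc, ← h, he])
      rw [← cancel_epi c, ← Category.assoc, ← Category.assoc, comp_lift, comp_lift]
      refine (lift_congr _ (by rw [Qa, Qa]) huq.symm hwq.symm).trans ((hadd e u w hu hw).trans ?_)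
      refine Eq.trans ?_ ((hadd e w u hw hu).symm.trans (lift_congr _ _ hwq huq))
      exact Qg _ _ rfl (M.ap_comm _ _ _ _ _)
    · intro T α β γ h h'
      obtain ⟨S, c, e, hc, he⟩ := cover (α ≫ a)
      obtain ⟨u, hu, huq⟩ := Qsurj (c ≫ α) e (by rw [Category.assoc, he])
      obtain ⟨w, hw, hwq⟩ := Qsurj (c ≫ β) e (by rw [Category.assoc, ← h, he])
      obtain ⟨z, hz, hzq⟩ := Qsurj (c ≫ γ) e (by rw [Category.assoc, ← h', ← h, he])
      rw [← cancel_epi c]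
      refine (Category.assoc _ _ _).symm.trans (Eq.trans ?_ (Category.assoc _ _ _))
      rw [comp_lift, comp_lift]
      have h1 : c ≫ pullback.lift α β h ≫ add = Q e (M.ap u e w hu.symm hw)
          (by rw [M.ap_f, hu]) := by
        rw [← Category.assoc, comp_lift]
        exact (lift_congr _ (by rw [Qa, Qa]) huq.symm hwq.symm).trans (hadd e u w hu hw)
      have h2 : c ≫ pullback.lift β γ h' ≫ add = Q e (M.ap w e z hw.symm hz)
          (by rw [M.ap_f, hw]) := by
        rw [← Category.assoc, comp_lift]
        exact (lift_congr _ (by rw [Qa, Qa]) hwq.symm hzq.symm).trans (hadd e w z hw hz)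
      refine (lift_congr _ (by rw [Qa, Qa]) h1 hzq.symm).trans ((hadd e _ z _ hz).trans ?_)
      refine Eq.trans ?_ ((hadd e u _ hu _).symm.trans (lift_congr _ _ huq h2.symm))
      exact Qg _ _ rfl (M.ap_assoc _ _ _ _ _ _ _ _ _)
  obtain ⟨ξ, hξ⟩ := AbAction.exists_of_point hb hκ
  refine ⟨ξ, ?_⟩
  have := hκ.mono
  -- the elements `(e, k b)` of `E ×_C E`
  let d : E ⨿ B ⟶ pullback f f := coprod.desc (pullback.lift (𝟙 E) (𝟙 E) rfl)
    (pullback.lift 0 k (by simp [hkf]))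
  have hd1 : d ≫ pullback.fst f f = coprod.desc (𝟙 E) 0 := by ext <;> simp [d]
  have hd2 : d ≫ pullback.snd f f = coprod.desc (𝟙 E) k := by ext <;> simp [d]
  have hdq : coprod.map f (𝟙 B) ≫ coprod.desc s κ = d ≫ q := by
    ext
    · simp [d, hs, Q]
    · simp [d, κ, Q]
  obtain ⟨y, hy⟩ := hk.exists_lift (flatι E B ≫ d ≫ pullback.snd f f) (by
    rw [Category.assoc, Category.assoc, ← pullback.condition, reassoc_of% hd1, ← Category.assoc,
      flatι_desc, zero_comp])
  have hyκ : flatMap f (𝟙 B) ≫ ξ.act = y := by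
    rw [← cancel_mono κ, Category.assoc, show ξ.act ≫ κ = _ from hξ, ← Category.assoc, flatMap_ι,
      Category.assoc, hdq]
    simp only [κ, Qc, Q]
    rw [← Category.assoc]
    congr 1
    apply pullback.hom_ext
    · simp [hd1, flatι_desc]
    · simp [hy]
  change flatMap f (𝟙 B) ≫ ξ.act ≫ k = flatι E B ≫ coprod.desc (𝟙 E) k
  rw [← Category.assoc, hyκ, hy, hd2]

end Direction

/-- The abelian action induced by an abelian extension. -/
def AbExt.action {C B : 𝒞} (X : AbExt C B) : AbAction C B := (exists_direction X).choose

theorem AbExt.induces_action {C B : 𝒞} (X : AbExt C B) : X.Induces X.action :=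
  (exists_direction X).choose_spec

/-- `(φ₀, φ₁)` is a morphism of abelian actions `ξ ⟶ ξ'`. -/
def IsEquivariant {C B C' B' : 𝒞} (ξ : AbAction C B) (ξ' : AbAction C' B') (φ₀ : C ⟶ C')
    (φ₁ : B ⟶ B') : Prop :=
  flatMap φ₀ φ₁ ≫ ξ'.act = ξ.act ≫ φ₁

/-- A morphism of extensions `X ⟶ Y` inducing `φ₀` on the quotients and `φ₁` on the kernels. -/
@[ext]
structure HomOver {C B C' B' : 𝒞} (φ₀ : C ⟶ C') (φ₁ : B ⟶ B') (X : AbExt C B)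
    (Y : AbExt C' B') where
  hom : X.E ⟶ Y.E
  comm_k : X.k ≫ hom = φ₁ ≫ Y.k
  comm_f : hom ≫ Y.f = X.f ≫ φ₀

/-- The composite of morphisms of extensions. -/
def HomOver.comp {C B C' B' C'' B'' : 𝒞} {φ₀ : C ⟶ C'} {φ₁ : B ⟶ B'} {ψ₀ : C' ⟶ C''}
    {ψ₁ : B' ⟶ B''} {X : AbExt C B} {Y : AbExt C' B'} {Z : AbExt C'' B''}
    (u : HomOver φ₀ φ₁ X Y) (w : HomOver ψ₀ ψ₁ Y Z) : HomOver (φ₀ ≫ ψ₀) (φ₁ ≫ ψ₁) X Z where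
  hom := u.hom ≫ w.hom
  comm_k := by rw [← Category.assoc, u.comm_k, Category.assoc, w.comm_k, Category.assoc]
  comm_f := by rw [Category.assoc, w.comm_f, ← Category.assoc, u.comm_f, Category.assoc]

/-- The category `OPEXT(C, B, ξ)` of abelian extensions of `C` by `B` inducing the action `ξ`:
the fibre over `ξ` of the functor sending an abelian extension to the induced action. -/
structure OpExt {C B : 𝒞} (ξ : AbAction C B) extends AbExt C B where
  induces : toAbExt.Induces ξ

/-- The morphisms of `OPEXT(C, B, ξ)` are those that restrict to the identities on `B` and `C`. -/
instance {C B : 𝒞} (ξ : AbAction C B) : Category (OpExt ξ) where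
  Hom X Y := HomOver (𝟙 C) (𝟙 B) X.toAbExt Y.toAbExt
  id X := ⟨𝟙 X.E, by simp, by simp⟩
  comp u w := ⟨u.hom ≫ w.hom, by simpa [HomOver.comp] using (u.comp w).comm_k,
    by simpa [HomOver.comp] using (u.comp w).comm_f⟩
  id_comp _ := HomOver.ext (Category.id_comp _)
  comp_id _ := HomOver.ext (Category.comp_id _)
  assoc _ _ _ := HomOver.ext (Category.assoc _ _ _)

/-- An abelian extension as an object of the fibre over the action that it induces. -/
def AbExt.toOpExt {C B : 𝒞} (X : AbExt C B) : OpExt X.action := ⟨X, X.induces_action⟩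

/-- The extension `g^*X` of `C` by `B`, for an abelian extension `X` of `C'` by `B` and
`g : C ⟶ C'`: the pullback of `X` along `g`, which induces the action `g^*ξ`. -/
def OpExt.baseChange {C C' B : 𝒞} {ξ : AbAction C' B} (X : OpExt ξ) (g : C ⟶ C') :
    OpExt (ξ.restrict g) where
  E := pullback X.f g
  k := pullback.lift X.k 0 (by simp [X.ker.1])
  f := pullback.snd X.f g
  ker := by
    have := X.ker.mono
    refine IsKer.of_lift (by simp) ⟨fun u v h => ?_⟩ ?_
    · have := congr($h ≫ pullback.fst _ _)
      simpa [cancel_mono] using this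
    · intro T x hx
      obtain ⟨y, hy⟩ := X.ker.exists_lift (x ≫ pullback.fst _ _) (by
        rw [Category.assoc, pullback.condition, ← Category.assoc, hx, zero_comp])
      refine ⟨y, ?_⟩
      apply pullback.hom_ext <;> simp [hy, hx]
  regEpi := by
    have := X.regEpi
    infer_instance
  abelian := by
    obtain ⟨M⟩ := X.abelian
    exact M.exists_pullback g
  induces := by
    have hm : flatMap (pullback.snd X.f g) (𝟙 B) ≫ flatMap g (𝟙 B) =
        flatMap (pullback.fst X.f g) (𝟙 B) ≫ flatMap X.f (𝟙 B) := by
      rw [← cancel_mono (flatι _ _)]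
      simp only [Category.assoc, flatMap_ι]
      simp only [← Category.assoc, flatMap_ι]
      simp [pullback.condition]
    change flatMap (pullback.snd X.f g) (𝟙 B) ≫ (flatMap g (𝟙 B) ≫ ξ.act) ≫
      pullback.lift X.k 0 _ = flatι _ B ≫ coprod.desc (𝟙 _) (pullback.lift X.k 0 _)
    rw [Category.assoc, reassoc_of% hm]
    apply pullback.hom_ext
    · simp only [Category.assoc, pullback.lift_fst]
      rw [show flatMap X.f (𝟙 B) ≫ ξ.act ≫ X.k = _ from X.induces, ← Category.assoc, flatMap_ι,
        Category.assoc]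
      congr 1
      ext <;> simp
    · have h0 : coprod.desc (𝟙 (pullback X.f g)) (pullback.lift X.k 0 (by simp [X.ker.1])) ≫
          pullback.snd X.f g =
            coprod.desc (𝟙 (pullback X.f g)) (0 : B ⟶ _) ≫ pullback.snd X.f g := by
        ext <;> simp
      simp only [Category.assoc, pullback.lift_snd, comp_zero]
      rw [h0, ← Category.assoc, flatι_desc, zero_comp]

/-- A Beck module `p : A ⟶ C` with kernel `k : B ⟶ A`, zero section `s` and associated action `ξ`
is an abelian extension inducing `ξ`. -/
theorem AbAction.induces_of_point {C B A : 𝒞} {ξ : AbAction C B} {p : A ⟶ C} {s : C ⟶ A}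
    {k : B ⟶ A} (h : IsBeckModule p s) (hk : IsKer k p) (hc : IsConjugation ξ.act s k) :
    flatMap p (𝟙 B) ≫ ξ.act ≫ k = flatι A B ≫ coprod.desc (𝟙 A) k := by
  obtain ⟨M⟩ := h.maltsev
  have hs := h.section_comp
  have hk0 : k ≫ p = 0 := hk.1
  -- `[1, k] = [1, 0] - [p s, 0] + [p s, k]`
  let x : A ⨿ B ⟶ A := coprod.desc (𝟙 A) 0
  let y : A ⨿ B ⟶ A := coprod.desc (𝟙 A) 0 ≫ p ≫ s
  let z : A ⨿ B ⟶ A := coprod.desc (p ≫ s) k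
  have hxy : x ≫ p = y ≫ p := by ext <;> simp [x, y, hs]
  have hyz : y ≫ p = z ≫ p := by ext <;> simp [y, z, hs, hk0]
  have mc {T : 𝒞} {a b c a' b' c' : T ⟶ A} (h : a ≫ p = b ≫ p) (h' : b ≫ p = c ≫ p)
      (ha : a = a') (hb : b = b') (hc : c = c') : M.ap a b c h h' =
        M.ap a' b' c' (by rw [← ha, ← hb, h]) (by rw [← hb, ← hc, h']) := by
    subst ha; subst hb; subst hc; rfl
  have key : M.ap x y z hxy hyz = coprod.desc (𝟙 A) k := by
    ext
    · rw [M.comp_ap, mc _ _ (c' := p ≫ s) (b' := p ≫ s) (a' := 𝟙 A), M.ap_right] <;>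
        simp [x, y, z]
    · rw [M.comp_ap, mc _ _ (c' := k) (b' := 0) (a' := 0), M.ap_left] <;> simp [x, y, z]
  have hz : coprod.map p (𝟙 B) ≫ coprod.desc s k = z := by simp [z]
  rw [show ξ.act ≫ k = _ from hc, ← Category.assoc, flatMap_ι, Category.assoc, hz, ← key, M.comp_ap]
  have h1 : flatι A B ≫ x = 0 := flatι_desc A B
  have h2 : flatι A B ≫ y = 0 := by
    change flatι A B ≫ x ≫ p ≫ s = 0
    rw [← Category.assoc, h1, zero_comp]
  rw [mc _ _ h1 h2 rfl, M.ap_left]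

/-- The semidirect product extension determined by the abelian action `ξ`, i.e. the Beck module
associated with `ξ`. It is the identity object of the categorical group `OPEXT(C, B, ξ)`. -/
def OpExt.unit {C B : 𝒞} (ξ : AbAction C B) : OpExt ξ where
  E := ξ.beck.choose
  f := ξ.beck.choose_spec.choose
  k := ξ.beck.choose_spec.choose_spec.choose_spec.choose
  ker := ξ.beck.choose_spec.choose_spec.choose_spec.choose_spec.2.1
  regEpi := by
    have := ξ.beck.choose_spec.choose_spec.choose_spec.choose_spec.1.section_comp
    have : IsSplitEpi ξ.beck.choose_spec.choose := IsSplitEpi.mk' ⟨_, this⟩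
    infer_instance
  abelian := ξ.beck.choose_spec.choose_spec.choose_spec.choose_spec.1.maltsev
  induces :=
    have h := ξ.beck.choose_spec.choose_spec.choose_spec.choose_spec
    AbAction.induces_of_point h.1 h.2.1 h.2.2

/-- The canonical section (zero section) of the semidirect product extension. -/
def OpExt.unitSection {C B : 𝒞} (ξ : AbAction C B) : C ⟶ (OpExt.unit ξ).E :=
  ξ.beck.choose_spec.choose_spec.choose

theorem OpExt.unit_spec {C B : 𝒞} (ξ : AbAction C B) :
    IsBeckModule (OpExt.unit ξ).f (OpExt.unitSection ξ) ∧
      IsKer (OpExt.unit ξ).k (OpExt.unit ξ).f ∧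
      IsConjugation ξ.act (OpExt.unitSection ξ) (OpExt.unit ξ).k :=
  ξ.beck.choose_spec.choose_spec.choose_spec.choose_spec

/-- The group `π₁` of the categorical group `OPEXT(C, B, ξ)`: the automorphism group of its
identity object. -/
abbrev Pi1 {C B : 𝒞} (ξ : AbAction C B) := Aut (OpExt.unit ξ)

/-- `F`, together with `u : X ⟶ F`, is a push forward `φ₁_*X` of the abelian extension `X` along
the morphism of actions `(1, φ₁)` with codomain `η`: `u` is an opcartesian lifting of `(1, φ₁)`
with respect to the functor sending an abelian extension of `C` to the induced action of `C`. -/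
def IsPushForward {C B B' : 𝒞} {η : AbAction C B'} {φ₁ : B ⟶ B'} (X : AbExt C B) (F : OpExt η)
    (u : HomOver (𝟙 C) φ₁ X F.toAbExt) : Prop :=
  ∀ {D : 𝒞} (ζ : AbAction C D) (G : OpExt ζ) (ψ : B' ⟶ D), IsEquivariant η ζ (𝟙 C) ψ →
    ∀ v : HomOver (𝟙 C) (φ₁ ≫ ψ) X G.toAbExt,
      ∃! w : HomOver (𝟙 C) ψ F.toAbExt G.toAbExt, u.hom ≫ w.hom = v.hom

/-- `τ : X ×_C A ⟶ X` is the translation of the extension `X` by the Beck module `A` of its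
action (the semidirect product extension): it lies over `C`, translation by the zero section is
the identity, and translating `0` by the elements of `B` gives the kernel inclusion of `X`.
(It is the map underlying the unit isomorphism `X ⊗ I ≅ X` for the Baer sum `⊗`.) -/
def IsTranslation {C B : 𝒞} {ξ : AbAction C B} (X : OpExt ξ)
    (τ : pullback X.f (OpExt.unit ξ).f ⟶ X.E) : Prop :=
  τ ≫ X.f = pullback.fst X.f (OpExt.unit ξ).f ≫ X.f ∧
  pullback.lift (𝟙 X.E) (X.f ≫ OpExt.unitSection ξ)
    (by simp [(OpExt.unit_spec ξ).1.section_comp]) ≫ τ = 𝟙 X.E ∧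
  pullback.lift 0 (OpExt.unit ξ).k (by simp [(OpExt.unit_spec ξ).2.1.1]) ≫ τ = X.k

/-- The endomorphism `1 ×_C a` of `X ×_C A` given by an endomorphism `a` of the semidirect product
extension `A`. -/
def idTimes {C B : 𝒞} {ξ : AbAction C B} (X : OpExt ξ) (a : OpExt.unit ξ ⟶ OpExt.unit ξ) :
    pullback X.f (OpExt.unit ξ).f ⟶ pullback X.f (OpExt.unit ξ).f :=
  pullback.lift (pullback.fst _ _) (pullback.snd _ _ ≫ a.hom)
    (by rw [Category.assoc, a.comm_f, Category.comp_id, pullback.condition])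

/-- The morphism `X ⟶ g^*Y` over the identity of `C` corresponding to a morphism of extensions
`X ⟶ Y` over `g`. -/
def HomOver.toBaseChange {C C' B B' : 𝒞} {g : C ⟶ C'} {b : B ⟶ B'} {X : AbExt C B}
    {ξ : AbAction C' B'} {Y : OpExt ξ} (u : HomOver g b X Y.toAbExt) :
    HomOver (𝟙 C) b X (Y.baseChange g).toAbExt where
  hom := pullback.lift u.hom X.f u.comm_f
  comm_k := by
    apply pullback.hom_ext <;> simp [OpExt.baseChange, u.comm_k, X.ker.1]
  comm_f := by simp [OpExt.baseChange]

/-- The projection `g^*Y ⟶ Y`. -/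
def OpExt.baseChangeFst {C C' B : 𝒞} {ξ : AbAction C' B} (Y : OpExt ξ) (g : C ⟶ C') :
    HomOver g (𝟙 B) (Y.baseChange g).toAbExt Y.toAbExt where
  hom := pullback.fst Y.f g
  comm_k := by simp [OpExt.baseChange]
  comm_f := pullback.condition

end Actions
end
end SemiAb

namespace SemiAb

noncomputable section

attribute [local simp] pullback.lift_fst pullback.lift_snd pullback.lift_fst_assoc
  pullback.lift_snd_assoc coprod.inl_desc coprod.inr_desc coprod.inl_desc_assoc
  coprod.inr_desc_assoc

/-! ### Generalized elements of pullbacks and local lifting along regular epimorphisms. -/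

variable {𝒞 : Type u} [Category.{v} 𝒞]

/-! An extension `X` inducing `ξ` is a torsor under the Beck module `A` of `ξ`. By
`Translation.nonempty` the Beck module acts on `X` by a map `(x, a) ↦ x + a` from `X ×_C A` to `X`,
and by `isIso_shear` the map `(x, a) ↦ (x, x + a)` onto the kernel pair is invertible, so
differences `y - x` in `A` exist and are unique. Conversely, such a translation yields the Mal'tsev
operation `x + (z - y)` and the induced action. By protomodularity `X ×_C A` is covered by `X` (at
the zero section) and by the kernel `B`; every algebraic law of translations is therefore tested
only at these two places.

The push forward along `φ₁` is the contracted product. A morphism of actions induces `m : A ⟶ A'`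
(`exists_pointMap`), and `φ₁_*X` is the quotient of `X ×_C A'` by `(e + b, a) ∼ (e, m b + a)`. It
inherits a translation by `A'`, hence is an abelian extension with the right action; a map `v` out
of `X` extends uniquely by `(e, a) ↦ v e + n a`.

For (i), a morphism `E ⟶ E'` over `φ₀` is a morphism `E ⟶ φ₀^*E'` over `C`. It factors through the
push forward, and the factor is invertible by the short five lemma.

For (ii), two morphisms `g`, `g'` from `E` to `φ₀^*E'` differ by `g' - g : E ⟶ A`. This vanishes on
`B` because both restrict to `φ₁` there, so it descends to a section of `A ⟶ C`. Sections `t` of `A`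
are the same as automorphisms `x ↦ x + t` of the identity object, which gives simple transitivity of
`π₁` (`existsUnique_translate`). Taking `E` equal to the target identifies `π₁` with its
automorphism group. -/

theorem comp_pullback_lift [HasPullbacks 𝒞] {X Y Z T S : 𝒞} {f : X ⟶ Z} {g : Y ⟶ Z} (t : S ⟶ T)
    (x : T ⟶ X)
    (y : T ⟶ Y) (h : x ≫ f = y ≫ g) :
    t ≫ pullback.lift x y h = pullback.lift (t ≫ x) (t ≫ y) (by simp [h]) := by
  apply pullback.hom_ext <;> simp

theorem eq_pullback_lift [HasPullbacks 𝒞] {X Y Z T : 𝒞} {f : X ⟶ Z} {g : Y ⟶ Z}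
    (t : T ⟶ pullback f g) :
    t = pullback.lift (t ≫ pullback.fst f g) (t ≫ pullback.snd f g)
      (by simp [pullback.condition]) := by
  apply pullback.hom_ext <;> simp

/-- A regular epimorphism lifts against monomorphisms. -/
theorem exists_factor_of_cover {S T X Y : 𝒞} (p : S ⟶ T) [IsRegularEpi p] (m : X ⟶ Y) [Mono m]
    (x : T ⟶ Y) (y : S ⟶ X) (h : y ≫ m = p ≫ x) : ∃ z : T ⟶ X, z ≫ m = x := by
  have sq : CommSq y p m x := ⟨h⟩
  exact ⟨sq.lift, sq.fac_right⟩

variable [HasZeroMorphisms 𝒞]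

/-- Kernels can be recognised locally. -/
theorem IsKer.of_local_lift {B E C : 𝒞} {k : B ⟶ E} {f : E ⟶ C} (w : k ≫ f = 0) (hk : Mono k)
    (h : ∀ {T : 𝒞} (x : T ⟶ E), x ≫ f = 0 →
      ∃ (S : 𝒞) (p : S ⟶ T) (y : S ⟶ B), IsRegularEpi p ∧ y ≫ k = p ≫ x) : IsKer k f :=
  IsKer.of_lift w hk fun x hx => by
    obtain ⟨S, p, y, hp, hy⟩ := h x hx
    exact exists_factor_of_cover p k x y hy

/-! ### Consequences of protomodularity: joint epimorphy, cokernels, the short five lemma. -/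

variable [SemiAbelian 𝒞]

/-- The section and the kernel of a split epimorphism are jointly extremally epic. -/
theorem isIso_of_factor {A C B I : 𝒞} {p : A ⟶ C} {s : C ⟶ A} {k : B ⟶ A} (hk : IsKer k p)
    (hs : s ≫ p = 𝟙 C) (m : I ⟶ A) [Mono m] (s' : C ⟶ I) (k' : B ⟶ I) (h₁ : s' ≫ m = s)
    (h₂ : k' ≫ m = k) : IsIso m := by
  have hm := hk.mono
  -- The subobject `I` is itself a split extension of `C` by `B`, so `m` is compared with identities
  -- at both ends.
  have hk' : IsKer k' (m ≫ p) := by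
    refine IsKer.of_lift (by rw [reassoc_of% h₂, hk.1]) ⟨fun u w h => ?_⟩ fun x hx => ?_
    · rw [← cancel_mono k, ← h₂, reassoc_of% h]
    · obtain ⟨y, hy⟩ := hk.exists_lift (x ≫ m) (by rw [Category.assoc, hx])
      exact ⟨y, by rw [← cancel_mono m, Category.assoc, h₂, hy]⟩
  exact SemiAbelian.splitShortFive (s := s') (s' := s) (𝟙 B) m (𝟙 C) hk' hk
    (by rw [reassoc_of% h₁, hs]) hs (by simp [h₂]) (by simp) (by simp [h₁]) inferInstance
    inferInstance

/-- The section and the kernel of a split epimorphism are jointly epic. -/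
theorem split_hom_ext {A C B Y : 𝒞} {p : A ⟶ C} {s : C ⟶ A} {k : B ⟶ A} (hk : IsKer k p)
    (hs : s ≫ p = 𝟙 C) {u w : A ⟶ Y} (h₁ : s ≫ u = s ≫ w) (h₂ : k ≫ u = k ≫ w) : u = w := by
  have := isIso_of_factor hk hs (equalizer.ι u w) (equalizer.lift s h₁) (equalizer.lift k h₂)
    (equalizer.lift_ι _ _) (equalizer.lift_ι _ _)
  rw [← cancel_epi (equalizer.ι u w), equalizer.condition]

/-- Pulling back does not change the kernel. Taking `g = p` turns any morphism with kernel `B` into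
a split epimorphism with kernel `B`, its kernel pair projection, to which the split results apply.
-/
theorem isKer_pullback_fst {X A C B : 𝒞} {p : A ⟶ C} {k : B ⟶ A} (hk : IsKer k p) (g : X ⟶ C) :
    IsKer (pullback.lift 0 k (by simp [hk.1]) : B ⟶ pullback g p) (pullback.fst g p) := by
  have := hk.mono
  refine IsKer.of_lift (by simp) ⟨fun u w h => ?_⟩ fun x hx => ?_
  · have := congr($h ≫ pullback.snd _ _)
    simpa [cancel_mono] using this
  · obtain ⟨y, hy⟩ := hk.exists_lift (x ≫ pullback.snd _ _) (by
      rw [Category.assoc, ← pullback.condition, ← Category.assoc, hx, zero_comp])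
    refine ⟨y, ?_⟩
    apply pullback.hom_ext <;> simp [hy, hx]

/-- Morphisms out of `X ×_C A`, for a split epimorphism `A ⟶ C`, are determined by their
restrictions to `X` and to the kernel. -/
theorem pullback_split_hom_ext {X A C B Y : 𝒞} {p : A ⟶ C} {s : C ⟶ A} {k : B ⟶ A}
    (hk : IsKer k p) (hs : s ≫ p = 𝟙 C) (g : X ⟶ C) {u w : pullback g p ⟶ Y}
    (h₁ : pullback.lift (𝟙 X) (g ≫ s) (by simp [hs]) ≫ u =
      pullback.lift (𝟙 X) (g ≫ s) (by simp [hs]) ≫ w)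
    (h₂ : pullback.lift 0 k (by simp [hk.1]) ≫ u = pullback.lift 0 k (by simp [hk.1]) ≫ w) :
    u = w :=
  split_hom_ext (isKer_pullback_fst hk g) (by simp) h₁ h₂

/-- The kernel pair of a morphism `f` with kernel `k` is covered by the diagonal and `(0, k)`. -/
theorem kernelPair_hom_ext {E C B Y : 𝒞} {f : E ⟶ C} {k : B ⟶ E} (hk : IsKer k f)
    {u w : pullback f f ⟶ Y}
    (h₁ : pullback.lift (𝟙 E) (𝟙 E) rfl ≫ u = pullback.lift (𝟙 E) (𝟙 E) rfl ≫ w)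
    (h₂ : pullback.lift 0 k (by simp [hk.1]) ≫ u = pullback.lift 0 k (by simp [hk.1]) ≫ w) :
    u = w :=
  split_hom_ext (isKer_pullback_fst hk f) (by simp) h₁ h₂

/-- A regular epimorphism is the cokernel of its kernel. -/
theorem exists_desc {E C B Y : 𝒞} {f : E ⟶ C} {k : B ⟶ E} (hk : IsKer k f) [IsRegularEpi f]
    (d : E ⟶ Y) (hd : k ≫ d = 0) : ∃ t : C ⟶ Y, f ≫ t = d := by
  -- Both composites are `d` on the diagonal; on `(0, k)` they are `0` and `k ≫ d = 0`.
  have key : pullback.fst f f ≫ d = pullback.snd f f ≫ d :=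
    kernelPair_hom_ext hk (by simp) (by simp [hd])
  have : ∀ {Z : 𝒞} (g₁ g₂ : Z ⟶ E), g₁ ≫ f = g₂ ≫ f → g₁ ≫ d = g₂ ≫ d := by
    intro Z g₁ g₂ h
    have := congr(pullback.lift g₁ g₂ h ≫ $key)
    simpa using this
  exact ⟨EffectiveEpi.desc f d this, EffectiveEpi.fac f d this⟩

/-- The short five lemma for extensions with the same quotient. -/
theorem isIso_of_shortFive {E E' C B B' : 𝒞} {f : E ⟶ C} {k : B ⟶ E} {f' : E' ⟶ C} {k' : B' ⟶ E'}
    (hk : IsKer k f) (hk' : IsKer k' f') [IsRegularEpi f] (β : B ⟶ B') [IsIso β] (α : E ⟶ E')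
    (h₁ : k ≫ α = β ≫ k') (h₂ : α ≫ f' = f) : IsIso α := by
  -- Pulling back along `f` splits both extensions, with sections the diagonal and `(1, α)`, so the
  -- split short five lemma applies to `m`.
  let m : pullback f f ⟶ pullback f f' := pullback.lift (pullback.fst f f) (pullback.snd f f ≫ α)
    (by simp [h₂, pullback.condition])
  have hm : IsIso m := by
    refine SemiAbelian.splitShortFive (s := pullback.lift (𝟙 E) (𝟙 E) rfl)
      (s' := pullback.lift (𝟙 E) α (by simp [h₂])) β m (𝟙 E) (isKer_pullback_fst hk f)
      (isKer_pullback_fst hk' f) (by simp) (by simp) ?_ (by simp [m]) ?_ inferInstance inferInstance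
    · apply pullback.hom_ext <;> simp [m, h₁]
    · apply pullback.hom_ext <;> simp [m]
  have hmono : Mono α := by
    refine ⟨fun {T} u w h => ?_⟩
    have hf : u ≫ f = w ≫ f := by rw [← h₂, reassoc_of% h]
    have : pullback.lift u u rfl = pullback.lift u w hf := by
      rw [← cancel_mono m]
      apply pullback.hom_ext <;> simp [m, h]
    simpa using congr($this ≫ pullback.snd f f)
  -- The projection `pullback.snd f f'` is a regular epimorphism, as a pullback of `f`; hence `α` is
  -- the last factor of a strong epimorphism.
  have e : m ≫ pullback.snd f f' = pullback.snd f f ≫ α := by simp [m]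
  have h3 : StrongEpi (pullback.snd f f ≫ α) := by
    rw [← e]
    exact strongEpi_comp _ _
  have := strongEpi_of_strongEpi (pullback.snd f f) α
  exact isIso_of_mono_of_strongEpi α

/-! ### From actions to split epimorphisms, and effective quotients. -/

/-- A morphism of actions induces a morphism between the corresponding split epimorphisms. -/
theorem exists_pointMap {C B A C' B' A' : 𝒞} {act : flat C B ⟶ B} {act' : flat C' B' ⟶ B'}
    {p : A ⟶ C} {s : C ⟶ A} {k : B ⟶ A} {s' : C' ⟶ A'} {k' : B' ⟶ A'}
    (hk : IsKer k p) (hs : s ≫ p = 𝟙 C) (hc : IsConjugation act s k)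
    (hc' : IsConjugation act' s' k') (φ₀ : C ⟶ C') (φ₁ : B ⟶ B')
    (hφ : flatMap φ₀ φ₁ ≫ act' = act ≫ φ₁) :
    ∃ α : A ⟶ A', s ≫ α = φ₀ ≫ s' ∧ k ≫ α = φ₁ ≫ k' := by
  have hkm := hk.mono
  let h : C ⨿ B ⟶ A := coprod.desc s k
  let h' : C ⨿ B ⟶ A' := coprod.desc (φ₀ ≫ s') (φ₁ ≫ k')
  -- The image of `(h, h')` in `A × A'` is the candidate graph of the required map `α`; it remains
  -- to see that its projection `π` to `A` is invertible.
  let F := Regular.strongEpiMonoFactorisation (prod.lift h h')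
  have e1 : F.e ≫ F.m ≫ prod.fst = h := by rw [← Category.assoc, F.fac, prod.lift_fst]
  have e2 : F.e ≫ F.m ≫ prod.snd = h' := by rw [← Category.assoc, F.fac, prod.lift_snd]
  let π : F.I ⟶ A := F.m ≫ prod.fst
  let κ : B ⟶ F.I := coprod.inr ≫ F.e
  let σ : C ⟶ F.I := coprod.inl ≫ F.e
  have hκ : κ ≫ π = k := by simp only [κ, π, Category.assoc, e1]; simp [h]
  have hσ : σ ≫ π = s := by simp only [σ, π, Category.assoc, e1]; simp [h]
  have hhp : h ≫ p = coprod.desc (𝟙 C) 0 := by ext <;> simp [h, hs, hk.1]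
  -- Equivariance enters here: on `C ♭ B` both `h` and `h'` factor through `act`, so this part of
  -- the image is no larger than `B`.
  have hflat : flatι C B ≫ F.e = act ≫ κ := by
    rw [← cancel_mono F.m]
    have : flatι C B ≫ h = act ≫ k := hc.symm
    have h2 : flatι C B ≫ h' = act ≫ φ₁ ≫ k' := by
      rw [← reassoc_of% hφ, show act' ≫ k' = _ from hc', ← Category.assoc, flatMap_ι]
      simp [h']
    apply prod.hom_ext
    · simp only [Category.assoc, e1, this]
      rw [show κ ≫ F.m ≫ prod.fst = k from hκ]
    · simp only [Category.assoc, e2, h2, κ]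
      simp [h']
  -- An element of the image killed by `π ≫ p` lifts locally to `C + B`, where it is killed by `[1,
  -- 0]`; it thus comes from `C ♭ B`, and by `hflat` from `B`.
  have hker : IsKer κ (π ≫ p) := by
    refine IsKer.of_local_lift (by rw [reassoc_of% hκ, hk.1]) (mono_of_mono_fac hκ)
      fun x hx => ?_
    have e1' : F.e ≫ π = h := e1
    refine ⟨pullback x F.e, pullback.fst _ _, flatLift (pullback.snd x F.e) ?_ ≫ act,
      inferInstance, ?_⟩
    · have e3 : F.e ≫ π ≫ p = coprod.desc (𝟙 C) 0 := by rw [reassoc_of% e1', hhp]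
      rw [← e3, ← reassoc_of% (pullback.condition (f := x) (g := F.e)), hx,
        comp_zero]
    · rw [Category.assoc, ← hflat, ← Category.assoc, flatLift_ι, pullback.condition]
  have : IsIso π := SemiAbelian.splitShortFive (s := σ) (s' := s) (𝟙 B) π (𝟙 C) hker hk
    (by rw [reassoc_of% hσ, hs]) hs (by simp [hκ]) (by simp) (by simp [hσ]) inferInstance
    inferInstance
  refine ⟨inv π ≫ F.m ≫ prod.snd, ?_, ?_⟩
  · rw [← hσ, Category.assoc, IsIso.hom_inv_id_assoc, Category.assoc, e2]; simp [h']
  · rw [← hκ, Category.assoc, IsIso.hom_inv_id_assoc, Category.assoc, e2]; simp [h']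

/-- Internal equivalence relations, described by generalized elements, are kernel pairs. -/
theorem exists_quotient_of_relation {R X : 𝒞} (p₁ p₂ : R ⟶ X)
    (inj : ∀ {T : 𝒞} (a b : T ⟶ R), a ≫ p₁ = b ≫ p₁ → a ≫ p₂ = b ≫ p₂ → a = b)
    (r : X ⟶ R) (r₁ : r ≫ p₁ = 𝟙 X) (r₂ : r ≫ p₂ = 𝟙 X)
    (s : R ⟶ R) (s₁ : s ≫ p₁ = p₂) (s₂ : s ≫ p₂ = p₁)
    (trans : ∀ {T : 𝒞} (a b : T ⟶ R), a ≫ p₂ = b ≫ p₁ →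
      ∃ c : T ⟶ R, c ≫ p₁ = a ≫ p₁ ∧ c ≫ p₂ = b ≫ p₂) :
    ∃ (Q : 𝒞) (q : X ⟶ Q), IsRegularEpi q ∧ IsPullback p₁ p₂ q q := by
  have hE : IsEquivalenceRelation p₁ p₂ := by
    -- Transitivity for generalized elements is applied to the universal composable pair.
    obtain ⟨t, t₁, t₂⟩ := trans (pullback.fst p₂ p₁) (pullback.snd p₂ p₁) pullback.condition
    exact ⟨⟨{ right_cancellation := fun _ a b h h' => inj a b h h'
              r := r
              reflexivity₁ := r₁
              reflexivity₂ := r₂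
              s := s
              symmetry₁ := s₁
              symmetry₂ := s₂
              c := pullback.cone p₂ p₁
              isLimit := pullback.isLimit p₂ p₁
              t := t
              transitivity₁ := t₁
              transitivity₂ := t₂ }⟩⟩
  obtain ⟨⟨eff⟩⟩ := SemiAbelian.effective p₁ p₂ hE
  refine ⟨eff.B, eff.π, ⟨⟨⟨R, p₁, p₂, eff.isPushout.w, ?_⟩⟩⟩, eff.isKernelPair⟩
  exact Cofork.IsColimit.mk' _ fun s => ⟨eff.isPushout.desc s.π s.π s.condition,
    eff.isPushout.inl_desc _ _ _, fun {m} hm => eff.isPushout.hom_ext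
      (hm.trans (eff.isPushout.inl_desc _ _ _).symm)
      (hm.trans (eff.isPushout.inl_desc _ _ _).symm)⟩

theorem flatMap_id (C B : 𝒞) : flatMap (𝟙 C) (𝟙 B) = 𝟙 (flat C B) := by
  rw [← cancel_mono (flatι _ _), flatMap_ι]; simp

theorem flatMap_comp {C B C' B' C'' B'' : 𝒞} (g : C ⟶ C') (b : B ⟶ B') (g' : C' ⟶ C'')
    (b' : B' ⟶ B'') : flatMap g b ≫ flatMap g' b' = flatMap (g ≫ g') (b ≫ b') := by
  rw [← cancel_mono (flatι _ _), Category.assoc, flatMap_ι, ← Category.assoc, flatMap_ι]; simp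

/-! ### Extensions as torsors under the Beck module of their action. -/

section Translation

variable {C B E : 𝒞} {ξ : AbAction C B}

theorem AbExt.k_f (X : AbExt C B) : X.k ≫ X.f = 0 := X.ker.1

theorem OpExt.unitSection_f (ξ : AbAction C B) :
    OpExt.unitSection ξ ≫ (OpExt.unit ξ).f = 𝟙 C := (OpExt.unit_spec ξ).1.section_comp

theorem OpExt.unitSection_f_assoc (ξ : AbAction C B) {Z : 𝒞} (z : C ⟶ Z) :
    OpExt.unitSection ξ ≫ (OpExt.unit ξ).f ≫ z = z := by
  rw [← Category.assoc, OpExt.unitSection_f, Category.id_comp]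

attribute [local simp] AbExt.k_f OpExt.unitSection_f OpExt.unitSection_f_assoc

theorem OpExt.unit_hom_ext {Y : 𝒞} {u w : (OpExt.unit ξ).E ⟶ Y}
    (h₁ : OpExt.unitSection ξ ≫ u = OpExt.unitSection ξ ≫ w)
    (h₂ : (OpExt.unit ξ).k ≫ u = (OpExt.unit ξ).k ≫ w) : u = w :=
  split_hom_ext (OpExt.unit ξ).ker (OpExt.unitSection_f ξ) h₁ h₂

/-- The test used for all laws below: an identity in variables `x` and `a` over `C` needs checking
only for `a` in the zero section, and for `x = 0` with `a` in `B`. -/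
theorem OpExt.pullback_unit_hom_ext {g : E ⟶ C} {Y : 𝒞}
    {u w : pullback g (OpExt.unit ξ).f ⟶ Y}
    (h₁ : pullback.lift (𝟙 E) (g ≫ OpExt.unitSection ξ) (by simp) ≫ u =
      pullback.lift (𝟙 E) (g ≫ OpExt.unitSection ξ) (by simp) ≫ w)
    (h₂ : pullback.lift 0 (OpExt.unit ξ).k (by simp) ≫ u =
      pullback.lift 0 (OpExt.unit ξ).k (by simp) ≫ w) : u = w :=
  pullback_split_hom_ext (OpExt.unit ξ).ker (OpExt.unitSection_f ξ) g h₁ h₂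

/-- A morphism of actions of `C` induces a morphism of the semidirect product extensions. -/
theorem IsEquivariant.exists_unit_map {B' : 𝒞} {ζ : AbAction C B'} {ψ : B ⟶ B'}
    (h : IsEquivariant ξ ζ (𝟙 C) ψ) :
    ∃ m : HomOver (𝟙 C) ψ (OpExt.unit ξ).toAbExt (OpExt.unit ζ).toAbExt,
      OpExt.unitSection ξ ≫ m.hom = OpExt.unitSection ζ := by
  obtain ⟨α, h₁, h₂⟩ := exists_pointMap (OpExt.unit ξ).ker (OpExt.unitSection_f ξ)
    (OpExt.unit_spec ξ).2.2 (OpExt.unit_spec ζ).2.2 (𝟙 C) ψ h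
  rw [Category.id_comp] at h₁
  exact ⟨⟨α, h₂, OpExt.unit_hom_ext (by simp [reassoc_of% h₁]) (by simp [reassoc_of% h₂])⟩, h₁⟩

/-- A translation of `f : E ⟶ C` (with kernel `k`) by the semidirect product extension of `ξ`. -/
structure Translation (ξ : AbAction C B) (k : B ⟶ E) (f : E ⟶ C) where
  map : pullback f (OpExt.unit ξ).f ⟶ E
  map_f : map ≫ f = pullback.fst f (OpExt.unit ξ).f ≫ f
  lift_zero : pullback.lift (𝟙 E) (f ≫ OpExt.unitSection ξ) (by simp) ≫ map = 𝟙 E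
  lift_ker : pullback.lift 0 (OpExt.unit ξ).k (by simp) ≫ map = k

namespace Translation

variable {k : B ⟶ E} {f : E ⟶ C}

/-- The pullback of the Beck module to `E` and the kernel pair of `f` with its diagonal are split
epimorphisms onto `E` with kernel `B`, and `E` acts on `B` in the same way in both. So
`exists_pointMap` gives a map between them over `E`; its second component is the translation. -/
theorem nonempty (hk : IsKer k f)
    (h : flatMap f (𝟙 B) ≫ ξ.act ≫ k = flatι E B ≫ coprod.desc (𝟙 E) k) :
    Nonempty (Translation ξ k f) := by
  have hkf := hk.1
  have c₁ : IsConjugation (flatMap f (𝟙 B) ≫ ξ.act)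
      (pullback.lift (𝟙 E) (f ≫ OpExt.unitSection ξ) (by simp) : E ⟶ pullback f (OpExt.unit ξ).f)
      (pullback.lift 0 (OpExt.unit ξ).k (by simp)) := by
    have hc := (OpExt.unit_spec ξ).2.2
    unfold IsConjugation at hc ⊢
    apply pullback.hom_ext
    · simp only [Category.assoc, pullback.lift_fst, comp_zero]
      rw [← flatι_desc E B]
      congr 1
      ext <;> simp
    · simp only [Category.assoc, pullback.lift_snd]
      rw [hc, ← Category.assoc, flatMap_ι, Category.assoc]
      congr 1
      ext <;> simp
  -- For the kernel pair, the second coordinate of this identity is exactly the hypothesis that the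
  -- extension induces `ξ`.
  have c₂ : IsConjugation (flatMap f (𝟙 B) ≫ ξ.act)
      (pullback.lift (𝟙 E) (𝟙 E) rfl : E ⟶ pullback f f)
      (pullback.lift 0 k (by simp [hkf])) := by
    unfold IsConjugation
    apply pullback.hom_ext
    · simp only [Category.assoc, pullback.lift_fst, comp_zero]
      rw [← flatι_desc E B]
      congr 1
      ext <;> simp
    · simp only [Category.assoc, pullback.lift_snd]
      rw [h]
      congr 1
      ext <;> simp
  obtain ⟨α, h₁, h₂⟩ := exists_pointMap (isKer_pullback_fst (OpExt.unit ξ).ker f) (by simp) c₁ c₂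
    (𝟙 E) (𝟙 B) (by rw [flatMap_id, Category.id_comp, Category.comp_id])
  replace h₁ := h₁.trans (Category.id_comp _)
  replace h₂ := h₂.trans (Category.id_comp _)
  have h₃ : α ≫ pullback.fst f f = pullback.fst f (OpExt.unit ξ).f :=
    OpExt.pullback_unit_hom_ext (by rw [reassoc_of% h₁]; simp) (by rw [reassoc_of% h₂]; simp)
  refine ⟨⟨α ≫ pullback.snd f f, ?_, ?_, ?_⟩⟩
  · rw [Category.assoc, ← pullback.condition, reassoc_of% h₃]
  · rw [reassoc_of% h₁, pullback.lift_snd]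
  · rw [reassoc_of% h₂, pullback.lift_snd]

variable (t : Translation ξ k f)

/-- The generalized element `x` of `E` translated by `a`. -/
def ap {T : 𝒞} (x : T ⟶ E) (a : T ⟶ (OpExt.unit ξ).E) (h : x ≫ f = a ≫ (OpExt.unit ξ).f) :
    T ⟶ E := pullback.lift x a h ≫ t.map

theorem map_eq : t.map = t.ap (pullback.fst _ _) (pullback.snd _ _) pullback.condition := by
  have : pullback.lift (pullback.fst f (OpExt.unit ξ).f) (pullback.snd _ _) pullback.condition =
      𝟙 _ := by apply pullback.hom_ext <;> simp
  rw [ap, this, Category.id_comp]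

theorem ap_f {T : 𝒞} (x : T ⟶ E) (a : T ⟶ (OpExt.unit ξ).E)
    (h : x ≫ f = a ≫ (OpExt.unit ξ).f) : t.ap x a h ≫ f = x ≫ f := by
  simp [ap, t.map_f]

theorem comp_ap {T S : 𝒞} (c : S ⟶ T) (x : T ⟶ E) (a : T ⟶ (OpExt.unit ξ).E)
    (h : x ≫ f = a ≫ (OpExt.unit ξ).f) :
    c ≫ t.ap x a h = t.ap (c ≫ x) (c ≫ a) (by simp [h]) := by
  rw [ap, ap, ← comp_pullback_lift, Category.assoc]

/-- The hypothesis forces `y = x ≫ f`. Leaving `y` free lets the simplifier recognise the zero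
section in whatever form its argument takes. -/
theorem ap_section {T : 𝒞} (x : T ⟶ E) (y : T ⟶ C)
    (h : x ≫ f = (y ≫ OpExt.unitSection ξ) ≫ (OpExt.unit ξ).f) :
    t.ap x (y ≫ OpExt.unitSection ξ) h = x := by
  obtain rfl : x ≫ f = y := by simpa using h
  have := congr(x ≫ $t.lift_zero)
  rw [← Category.assoc, comp_pullback_lift] at this
  simpa [ap] using this

theorem ap_zero {T : 𝒞} (x : T ⟶ E) (h : x ≫ f = 0 ≫ (OpExt.unit ξ).f) : t.ap x 0 h = x := by
  have := t.ap_section x 0 (by simpa using h)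
  simpa only [zero_comp] using this

theorem zero_ap_ker {T : 𝒞} (b : T ⟶ B)
    (h : (0 : T ⟶ E) ≫ f = (b ≫ (OpExt.unit ξ).k) ≫ (OpExt.unit ξ).f) :
    t.ap 0 (b ≫ (OpExt.unit ξ).k) h = b ≫ k := by
  have := congr(b ≫ $t.lift_ker)
  rw [← Category.assoc, comp_pullback_lift] at this
  simpa only [comp_zero, ap] using this

theorem zero_ap_ker' (h : (0 : B ⟶ E) ≫ f = (OpExt.unit ξ).k ≫ (OpExt.unit ξ).f) :
    t.ap 0 (OpExt.unit ξ).k h = k := t.lift_ker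

attribute [local simp] ap_f comp_ap ap_section ap_zero zero_ap_ker zero_ap_ker'

/-- The morphism `(x, a) ↦ (x, x + a)` is invertible. -/
theorem isIso_shear (hk : IsKer k f) :
    IsIso (pullback.lift (pullback.fst f (OpExt.unit ξ).f) t.map t.map_f.symm) := by
  have hkf := hk.1
  -- Source and target are split epimorphisms onto `E` with kernel `B`; the shear carries the zero
  -- section to the diagonal and is the identity on kernels.
  refine SemiAbelian.splitShortFive
    (s := pullback.lift (𝟙 E) (f ≫ OpExt.unitSection ξ) (by simp))
    (s' := pullback.lift (𝟙 E) (𝟙 E) rfl) (𝟙 B) _ (𝟙 E)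
    (isKer_pullback_fst (OpExt.unit ξ).ker f) (isKer_pullback_fst hk f) (by simp) (by simp) ?_
    (by simp) ?_ inferInstance inferInstance
  · apply pullback.hom_ext <;> simp [t.lift_ker]
  · apply pullback.hom_ext <;> simp [t.lift_zero]

/-- The inverse of the shear, applied to `(x, y)`, has second component the difference `y - x`. -/
theorem exists_ap_eq (hk : IsKer k f) {T : 𝒞} (x y : T ⟶ E) (h : x ≫ f = y ≫ f) :
    ∃ (a : T ⟶ (OpExt.unit ξ).E) (h' : x ≫ f = a ≫ (OpExt.unit ξ).f), t.ap x a h' = y := by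
  have := t.isIso_shear hk
  let m := pullback.lift (pullback.fst f (OpExt.unit ξ).f) t.map t.map_f.symm
  let z := pullback.lift x y h ≫ inv m
  have hz : z ≫ m = pullback.lift x y h := by simp [z]
  have h₁ : z ≫ pullback.fst f (OpExt.unit ξ).f = x := by
    simpa [m] using congr($hz ≫ pullback.fst f f)
  have h₂ : z ≫ t.map = y := by
    simpa [m] using congr($hz ≫ pullback.snd f f)
  refine ⟨z ≫ pullback.snd _ _, by simp [← h₁, pullback.condition], ?_⟩
  rw [← h₂, map_eq, comp_ap]
  simp only [h₁]

/-- Uniqueness of differences, since the shear is a monomorphism. -/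
theorem ap_injective (hk : IsKer k f) {T : 𝒞} {x : T ⟶ E} {a b : T ⟶ (OpExt.unit ξ).E}
    {ha : x ≫ f = a ≫ (OpExt.unit ξ).f} {hb : x ≫ f = b ≫ (OpExt.unit ξ).f}
    (h : t.ap x a ha = t.ap x b hb) : a = b := by
  have := t.isIso_shear hk
  have : pullback.lift x a ha = pullback.lift x b hb := by
    rw [← cancel_mono (pullback.lift (pullback.fst f (OpExt.unit ξ).f) t.map t.map_f.symm)]
    apply pullback.hom_ext
    · simp
    · simpa [ap] using h
  simpa using congr($this ≫ pullback.snd _ _)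

/-- Morphisms of extensions are compatible with translations. -/
theorem ap_comp {B' E' : 𝒞} {ζ : AbAction C B'} {k' : B' ⟶ E'} {f' : E' ⟶ C}
    (t' : Translation ζ k' f') {ψ : B ⟶ B'}
    (m : HomOver (𝟙 C) ψ (OpExt.unit ξ).toAbExt (OpExt.unit ζ).toAbExt)
    (hm : OpExt.unitSection ξ ≫ m.hom = OpExt.unitSection ζ) (φ : E ⟶ E')
    (h₁ : k ≫ φ = ψ ≫ k') (h₂ : φ ≫ f' = f) {T : 𝒞} (x : T ⟶ E) (a : T ⟶ (OpExt.unit ξ).E)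
    (h : x ≫ f = a ≫ (OpExt.unit ξ).f) :
    t.ap x a h ≫ φ = t'.ap (x ≫ φ) (a ≫ m.hom) (by simp [h₂, h, m.comm_f]) := by
  -- It suffices to treat the universal pair `(x, a)`, where both sides are compared on `E` and on
  -- `B`.
  have key : t.map ≫ φ = t'.ap (pullback.fst _ _ ≫ φ) (pullback.snd _ _ ≫ m.hom)
      (by simp [h₂, pullback.condition, m.comm_f]) := by
    apply OpExt.pullback_unit_hom_ext
    · simp [reassoc_of% t.lift_zero, hm]
    · simp [reassoc_of% t.lift_ker, m.comm_k, h₁]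
  rw [ap, Category.assoc, key]
  simp

end Translation

/-- The translation of an abelian extension by the Beck module of its action. -/
def OpExt.translation (X : OpExt ξ) : Translation ξ X.k X.f :=
  (Translation.nonempty X.ker X.induces).some

/-- The addition of the Beck module of `ξ`. -/
def addition (ξ : AbAction C B) : Translation ξ (OpExt.unit ξ).k (OpExt.unit ξ).f :=
  (OpExt.unit ξ).translation

/-! ### Group laws of the Beck module, and the Mal'tsev operation of a torsor. -/

namespace Translation

attribute [local simp] ap_f comp_ap ap_section ap_zero zero_ap_ker zero_ap_ker'

variable {k : B ⟶ E} {f : E ⟶ C} {T : 𝒞}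

/-- The map `addition ξ` is only known to be a translation, so zero is a right unit by definition,
while the left unit law has to be checked on the zero section and on the kernel. -/
theorem section_add (y : T ⟶ C) (a : T ⟶ (OpExt.unit ξ).E)
    (h : (y ≫ OpExt.unitSection ξ) ≫ (OpExt.unit ξ).f = a ≫ (OpExt.unit ξ).f) :
    (addition ξ).ap (y ≫ OpExt.unitSection ξ) a h = a := by
  obtain rfl : y = a ≫ (OpExt.unit ξ).f := by simpa using h
  have key : (addition ξ).ap ((OpExt.unit ξ).f ≫ OpExt.unitSection ξ) (𝟙 _) (by simp) = 𝟙 _ := by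
    apply OpExt.unit_hom_ext
    · have := (addition ξ).ap_section (OpExt.unitSection ξ) (𝟙 C) (by simp)
      simpa using this
    · simp [reassoc_of% (OpExt.unit ξ).k_f]
  have := congr(a ≫ $key)
  simpa using this

/-- Commutativity comes from the two unit laws alone: they fix both sides on the two pieces covering
`A ×_C A`. -/
theorem add_comm (a b : T ⟶ (OpExt.unit ξ).E)
    (h : a ≫ (OpExt.unit ξ).f = b ≫ (OpExt.unit ξ).f) :
    (addition ξ).ap a b h = (addition ξ).ap b a h.symm := by
  have key : (addition ξ).map = (addition ξ).ap (pullback.snd _ _) (pullback.fst _ _)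
      pullback.condition.symm := by
    apply OpExt.pullback_unit_hom_ext
    · rw [lift_zero]
      simp [section_add]
    · rw [lift_ker]
      simp
  rw [ap, key]
  simp

/-- The universal case lives on `E ×_C A ×_C A`, viewed as a pullback of `A` along `g`. Testing in
the last variable leaves the case where `b` is zero and the case where only `b` is nonzero. -/
theorem ap_ap (t : Translation ξ k f) (x : T ⟶ E) (a b : T ⟶ (OpExt.unit ξ).E)
    (h : x ≫ f = a ≫ (OpExt.unit ξ).f)
    (h' : a ≫ (OpExt.unit ξ).f = b ≫ (OpExt.unit ξ).f) :
    t.ap (t.ap x a h) b (by rw [ap_f, h, h']) =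
      t.ap x ((addition ξ).ap a b h') (by rw [ap_f, h]) := by
  let g : pullback f (OpExt.unit ξ).f ⟶ C := pullback.snd _ _ ≫ (OpExt.unit ξ).f
  have hg : (pullback.fst g (OpExt.unit ξ).f ≫ t.map) ≫ f =
      pullback.snd g (OpExt.unit ξ).f ≫ (OpExt.unit ξ).f := by
    rw [Category.assoc, t.map_f, pullback.condition (f := f), ← pullback.condition (f := g)]
  have hg' : (pullback.fst g (OpExt.unit ξ).f ≫ pullback.snd _ _) ≫ (OpExt.unit ξ).f =
      pullback.snd g (OpExt.unit ξ).f ≫ (OpExt.unit ξ).f := by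
    rw [Category.assoc, ← pullback.condition (f := g)]
  have key : t.ap (pullback.fst g (OpExt.unit ξ).f ≫ t.map) (pullback.snd _ _) hg =
      t.ap (pullback.fst g (OpExt.unit ξ).f ≫ pullback.fst _ _)
        ((addition ξ).ap (pullback.fst g (OpExt.unit ξ).f ≫ pullback.snd _ _)
          (pullback.snd _ _) hg') (by simp [pullback.condition]) := by
    apply OpExt.pullback_unit_hom_ext
    · simp only [comp_ap, pullback.lift_snd, pullback.lift_fst_assoc,
        ap_section, Category.id_comp]
      exact t.map_eq
    · simp
  have := congr(pullback.lift (pullback.lift x a h) b (by simp [g, h']) ≫ $key)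
  simp only [comp_ap, pullback.lift_fst, pullback.lift_snd, pullback.lift_fst_assoc] at this
  exact this

theorem ap_right_comm (t : Translation ξ k f) (x : T ⟶ E) (a b : T ⟶ (OpExt.unit ξ).E)
    (h : x ≫ f = a ≫ (OpExt.unit ξ).f) (h' : x ≫ f = b ≫ (OpExt.unit ξ).f) :
    t.ap (t.ap x a h) b (by rw [ap_f, h']) = t.ap (t.ap x b h') a (by rw [ap_f, h]) := by
  rw [ap_ap _ _ _ _ _ (h.symm.trans h'), ap_ap _ _ _ _ _ (h'.symm.trans h)]
  simp only [add_comm a b]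

/-- The translation determines the induced action. -/
theorem induces (t : Translation ξ k f) :
    flatMap f (𝟙 B) ≫ ξ.act ≫ k = flatι E B ≫ coprod.desc (𝟙 E) k := by
  let j : B ⟶ pullback f (OpExt.unit ξ).f := pullback.lift 0 (OpExt.unit ξ).k (by simp)
  -- The conjugation identity holds in `E ×_C A` because it holds in the semidirect product; the
  -- translation then carries it to `E`.
  have hj : flatMap f (𝟙 B) ≫ ξ.act ≫ j = flatι E B ≫ coprod.desc
      (pullback.lift (𝟙 E) (f ≫ OpExt.unitSection ξ) (by simp)) j := by
    apply pullback.hom_ext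
    · simp only [j, Category.assoc, pullback.lift_fst, comp_zero]
      rw [← flatι_desc E B]
      congr 1
      ext <;> simp
    · simp only [j, Category.assoc, pullback.lift_snd]
      rw [show ξ.act ≫ (OpExt.unit ξ).k = _ from (OpExt.unit_spec ξ).2.2, ← Category.assoc,
        flatMap_ι, Category.assoc]
      congr 1
      ext <;> simp
  have := congr($hj ≫ t.map)
  simp only [Category.assoc, j, t.lift_ker] at this
  rw [this]
  congr 1
  ext <;> simp [t.lift_zero, t.lift_ker]

/-- The Mal'tsev operation `(x, y, z) ↦ x + (z - y)`. -/
theorem maltsev (t : Translation ξ k f) (hk : IsKer k f) : Nonempty (MaltsevOp f) := by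
  let P := pullback (pullback.snd f f) (pullback.fst f f)
  -- Here `δ = z - y` for the universal triple `(x, y, z)`.
  obtain ⟨δ, hδ, hδ'⟩ := t.exists_ap_eq hk _ _ (triple_proj₂₃ f)
  let o : P ⟶ E := t.ap _ δ ((triple_proj₁₂ f).trans hδ)
  -- The operation may be computed from any `a` with `y + a = z`, since such an `a` is unique.
  have key {T : 𝒞} (x y z : T ⟶ E) (h : x ≫ f = y ≫ f) (h' : y ≫ f = z ≫ f)
      (a : T ⟶ (OpExt.unit ξ).E) (ha : y ≫ f = a ≫ (OpExt.unit ξ).f) (hz : t.ap y a ha = z) :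
      triple x y z h h' ≫ o = t.ap x a (h.trans ha) := by
    have e₁ : triple x y z h h' ≫ pullback.fst (pullback.snd f f) (pullback.fst f f) ≫
      pullback.fst f f = x := by simp [triple]
    have e₂ : triple x y z h h' ≫ pullback.fst (pullback.snd f f) (pullback.fst f f) ≫
      pullback.snd f f = y := by simp [triple]
    have e₃ : triple x y z h h' ≫ pullback.snd (pullback.snd f f) (pullback.fst f f) ≫
      pullback.snd f f = z := by simp [triple]
    have e₄ : triple x y z h h' ≫ δ = a := by
      refine t.ap_injective hk (x := y) (hb := ha) (ha := ?_) ?_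
      · rw [Category.assoc, ← hδ, ← Category.assoc, e₂]
      · have := congr(triple x y z h h' ≫ $hδ')
        rw [comp_ap, e₃] at this
        simp only [e₂] at this
        exact this.trans hz.symm
    simp only [o, comp_ap, e₁, e₄]
  refine ⟨⟨o, by simp [o], ?_, ?_, ?_, ?_⟩⟩
  · intro T x y h
    obtain ⟨a, ha, rfl⟩ := t.exists_ap_eq hk x y h
    rw [key _ _ _ _ _ a ha rfl]
  · intro T x y h
    rw [key _ _ _ _ _ ((y ≫ f) ≫ OpExt.unitSection ξ) (by simp) (t.ap_section _ _ _),
      ap_section]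
  · intro T x y z u w hxy hyz hzu huw h h'
    obtain ⟨a, ha, ha'⟩ := t.exists_ap_eq hk y z hyz
    obtain ⟨b, hb, hb'⟩ := t.exists_ap_eq hk u w huw
    have hab : a ≫ (OpExt.unit ξ).f = b ≫ (OpExt.unit ξ).f := by rw [← ha, hyz, hzu, hb]
    rw [key _ _ _ h huw b hb hb']
    simp only [key x y z hxy hyz a ha ha']
    -- With `z = y + a` and `w = u + b`, both bracketings equal `x + (a + b)`.
    have e : triple z u w hzu huw ≫ o = t.ap y ((addition ξ).ap a b hab) (by simp [ha]) := by
      rw [key z u w hzu huw b hb hb', ← ap_ap _ _ _ _ ha]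
      simp only [ha']
    rw [key x y _ hxy h' _ _ e.symm, ap_ap _ _ _ _ (hxy.trans ha)]
  · intro T x y z hxy hyz
    -- Writing `x = y + a` and `z = y + b`, the claim becomes `y + a + b = y + b + a`.
    obtain ⟨a, ha, rfl⟩ := t.exists_ap_eq hk y x hxy.symm
    obtain ⟨b, hb, rfl⟩ := t.exists_ap_eq hk y z hyz
    rw [key _ _ _ _ _ b hb rfl, key _ _ _ _ _ a ha rfl, ap_right_comm]

end Translation

end Translation

attribute [local simp] AbExt.k_f OpExt.unitSection_f OpExt.unitSection_f_assoc
  Translation.ap_f Translation.comp_ap Translation.ap_section Translation.ap_zero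
  Translation.zero_ap_ker Translation.zero_ap_ker' Translation.section_add

/-! ### Construction and universal property of the push forward. -/

section PushForward

variable {C B B' : 𝒞} {ξ : AbAction C B} {η : AbAction C B'} {φ₁ : B ⟶ B'}

theorem Translation.zero_add {T : 𝒞} (a : T ⟶ (OpExt.unit ξ).E)
    (h : 0 ≫ (OpExt.unit ξ).f = a ≫ (OpExt.unit ξ).f) : (addition ξ).ap 0 a h = a := by
  have := section_add 0 a (by simpa using h)
  simpa only [zero_comp] using this

/-- Additivity of the morphisms of Beck modules induced by a morphism of actions. -/
theorem add_comp (m : HomOver (𝟙 C) φ₁ (OpExt.unit ξ).toAbExt (OpExt.unit η).toAbExt)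
    (hm : OpExt.unitSection ξ ≫ m.hom = OpExt.unitSection η) {T : 𝒞}
    (a b : T ⟶ (OpExt.unit ξ).E) (h : a ≫ (OpExt.unit ξ).f = b ≫ (OpExt.unit ξ).f) :
    (addition ξ).ap a b h ≫ m.hom =
      (addition η).ap (a ≫ m.hom) (b ≫ m.hom) (by simp [h, m.comm_f]) :=
  (addition ξ).ap_comp (addition η) m hm m.hom m.comm_k (by simp [m.comm_f]) a b h

/-- The quotient of `X ×_C A'` which identifies `(e + b, a)` with `(e, m b + a)`. -/
theorem exists_balanced_quotient (X : OpExt ξ)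
    (m : HomOver (𝟙 C) φ₁ (OpExt.unit ξ).toAbExt (OpExt.unit η).toAbExt)
    (hm : OpExt.unitSection ξ ≫ m.hom = OpExt.unitSection η) :
    ∃ (F : 𝒞) (q : pullback X.f (OpExt.unit η).f ⟶ F), IsRegularEpi q ∧
      (∀ {T : 𝒞} (e : T ⟶ X.E) (b : T ⟶ (OpExt.unit ξ).E) (a : T ⟶ (OpExt.unit η).E)
        (h : e ≫ X.f = b ≫ (OpExt.unit ξ).f) (h' : e ≫ X.f = a ≫ (OpExt.unit η).f),
        pullback.lift (X.translation.ap e b h) a (by rw [Translation.ap_f, h']) ≫ q =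
          pullback.lift e ((addition η).ap (b ≫ m.hom) a (by simp [m.comm_f, ← h, h']))
            (by simp [m.comm_f, h]) ≫ q) ∧
      (∀ {T : 𝒞} (x y : T ⟶ pullback X.f (OpExt.unit η).f), x ≫ q = y ≫ q →
        ∃ (e : T ⟶ X.E) (b : T ⟶ (OpExt.unit ξ).E) (a : T ⟶ (OpExt.unit η).E)
        (h : e ≫ X.f = b ≫ (OpExt.unit ξ).f) (h' : e ≫ X.f = a ≫ (OpExt.unit η).f),
        x = pullback.lift (X.translation.ap e b h) a (by rw [Translation.ap_f, h']) ∧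
        y = pullback.lift e ((addition η).ap (b ≫ m.hom) a (by simp [m.comm_f, ← h, h']))
            (by simp [m.comm_f, h])) := by
  let g : pullback X.f (OpExt.unit ξ).f ⟶ C := pullback.fst _ _ ≫ X.f
  -- `R` consists of triples `(e, b, a)` over `C`, witnessing that `(e + b, a)` (by `p₁`) is related
  -- to `(e, m b + a)` (by `p₂`).
  let R := pullback g (OpExt.unit η).f
  let re : R ⟶ X.E := pullback.fst _ _ ≫ pullback.fst _ _
  let rb : R ⟶ (OpExt.unit ξ).E := pullback.fst _ _ ≫ pullback.snd _ _
  let ra : R ⟶ (OpExt.unit η).E := pullback.snd _ _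
  have hb : re ≫ X.f = rb ≫ (OpExt.unit ξ).f := by
    simp only [re, rb, Category.assoc, pullback.condition]
  have ha : re ≫ X.f = ra ≫ (OpExt.unit η).f := by
    simp only [re, ra, Category.assoc, ← pullback.condition (f := g)]
    rfl
  have hba : (rb ≫ m.hom) ≫ (OpExt.unit η).f = ra ≫ (OpExt.unit η).f := by
    rw [← ha, hb, Category.assoc, m.comm_f, Category.comp_id]
  let mk {T : 𝒞} (e : T ⟶ X.E) (b : T ⟶ (OpExt.unit ξ).E) (a : T ⟶ (OpExt.unit η).E)
      (h : e ≫ X.f = b ≫ (OpExt.unit ξ).f) (h' : e ≫ X.f = a ≫ (OpExt.unit η).f) : T ⟶ R :=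
    pullback.lift (pullback.lift e b h) a (by simp [g, h'])
  have mk_e {T : 𝒞} (e : T ⟶ X.E) (b : T ⟶ (OpExt.unit ξ).E) (a : T ⟶ (OpExt.unit η).E)
      (h : e ≫ X.f = b ≫ (OpExt.unit ξ).f) (h' : e ≫ X.f = a ≫ (OpExt.unit η).f) :
      mk e b a h h' ≫ re = e := by simp [mk, re]
  have mk_b {T : 𝒞} (e : T ⟶ X.E) (b : T ⟶ (OpExt.unit ξ).E) (a : T ⟶ (OpExt.unit η).E)
      (h : e ≫ X.f = b ≫ (OpExt.unit ξ).f) (h' : e ≫ X.f = a ≫ (OpExt.unit η).f) :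
      mk e b a h h' ≫ rb = b := by simp [mk, rb]
  have mk_a {T : 𝒞} (e : T ⟶ X.E) (b : T ⟶ (OpExt.unit ξ).E) (a : T ⟶ (OpExt.unit η).E)
      (h : e ≫ X.f = b ≫ (OpExt.unit ξ).f) (h' : e ≫ X.f = a ≫ (OpExt.unit η).f) :
      mk e b a h h' ≫ ra = a := by simp [mk, ra]
  have ext_R {T : 𝒞} (x y : T ⟶ R) (h₁ : x ≫ re = y ≫ re) (h₂ : x ≫ rb = y ≫ rb)
      (h₃ : x ≫ ra = y ≫ ra) : x = y := by
    apply pullback.hom_ext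
    · apply pullback.hom_ext
      · simpa [re] using h₁
      · simpa [rb] using h₂
    · exact h₃
  have hT {T : 𝒞} (x : T ⟶ R) {Y Z : 𝒞} {u : R ⟶ Y} {w : R ⟶ Z} {u' : Y ⟶ C} {w' : Z ⟶ C}
      (h : u ≫ u' = w ≫ w') : (x ≫ u) ≫ u' = (x ≫ w) ≫ w' := by simp [h]
  let p₁ : R ⟶ pullback X.f (OpExt.unit η).f := pullback.lift (X.translation.ap re rb hb) ra
    (by rw [Translation.ap_f, ha])
  let p₂ : R ⟶ pullback X.f (OpExt.unit η).f := pullback.lift re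
    ((addition η).ap (rb ≫ m.hom) ra hba) (by rw [Translation.ap_f, hba, ha])
  have hp₁ {T : 𝒞} (x : T ⟶ R) : x ≫ p₁ = pullback.lift
      (X.translation.ap (x ≫ re) (x ≫ rb) (hT x hb)) (x ≫ ra)
      (by rw [Translation.ap_f, hT x ha]) := by
    rw [comp_pullback_lift]
    simp only [Translation.comp_ap]
  have hp₂ {T : 𝒞} (x : T ⟶ R) : x ≫ p₂ = pullback.lift (x ≫ re)
      ((addition η).ap (x ≫ rb ≫ m.hom) (x ≫ ra) (hT x hba))
      (by rw [Translation.ap_f, hT x hba, hT x ha]) := by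
    rw [comp_pullback_lift]
    simp only [Translation.comp_ap]
  have hab {T : 𝒞} {e e' : T ⟶ X.E} {a a' : T ⟶ (OpExt.unit η).E} {h h'}
      (h0 : pullback.lift e a h = (pullback.lift e' a' h' : T ⟶ pullback X.f (OpExt.unit η).f)) :
      e = e' ∧ a = a' :=
    ⟨by simpa using congr($h0 ≫ pullback.fst _ _), by simpa using congr($h0 ≫ pullback.snd _ _)⟩
  -- the opposite of `rb`
  obtain ⟨n, hn, hn'⟩ := (addition ξ).exists_ap_eq (OpExt.unit ξ).ker rb
    ((rb ≫ (OpExt.unit ξ).f) ≫ OpExt.unitSection ξ) (by simp)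
  have hsymm : (addition η).ap (n ≫ m.hom) ((addition η).ap (rb ≫ m.hom) ra hba)
      (by simp [m.comm_f, hn]) = ra := by
    rw [← Translation.ap_ap]
    · have h₁ := Translation.add_comm (ξ := η) (n ≫ m.hom) (rb ≫ m.hom)
        (by simp [m.comm_f, hn])
      rw [← add_comp m hm rb n hn, hn'] at h₁
      simp only [h₁, Category.assoc, hm]
      have h₂ := Translation.section_add (ξ := η) (rb ≫ (OpExt.unit ξ).f) ra
        (by rw [← hb, ha]; simp)
      simpa only [Category.assoc] using h₂
    · simp [m.comm_f, hn]
  obtain ⟨F, q, hq, hpb⟩ : ∃ (F : 𝒞) (q : pullback X.f (OpExt.unit η).f ⟶ F),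
      IsRegularEpi q ∧ IsPullback p₁ p₂ q q := by
    refine exists_quotient_of_relation p₁ p₂ ?_
      -- Reflexivity is witnessed by `(e, 0, a)`.
      (mk (pullback.fst _ _) ((pullback.fst _ _ ≫ X.f) ≫ OpExt.unitSection ξ) (pullback.snd _ _)
        (by simp) pullback.condition) ?_ ?_
      -- Symmetry is witnessed by `(e + b, -b, m b + a)`; `hsymm` cancels `m (-b)` against `m b`.
      (mk (X.translation.ap re rb hb) n ((addition η).ap (rb ≫ m.hom) ra hba)
        (by rw [Translation.ap_f, hb, hn]) (by rw [Translation.ap_f, Translation.ap_f, hba, ha]))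
      ?_ ?_ ?_
    · intro T x y h₁ h₂
      rw [hp₁, hp₁] at h₁
      rw [hp₂, hp₂] at h₂
      have he := (hab h₂).1
      refine ext_R _ _ he ?_ (hab h₁).2
      -- A witness is determined by its endpoints: `p₂` gives `e`, `p₁` gives `a` and `e + b`, and
      -- then `b` is a difference.
      refine X.translation.ap_injective X.ker (x := x ≫ re) (ha := hT x hb)
        (hb := by rw [he]; exact hT y hb) ?_
      rw [(hab h₁).1]
      simp only [he]
    · rw [hp₁]
      simp only [mk_e, mk_b, mk_a, Translation.ap_section]
      apply pullback.hom_ext <;> simp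
    · rw [hp₂]
      simp only [mk_e, reassoc_of% mk_b, mk_a, Category.assoc, hm]
      have h₂ := Translation.section_add (ξ := η) (pullback.fst _ _ ≫ X.f)
        (pullback.snd X.f (OpExt.unit η).f) (by simp [pullback.condition])
      simp only [Category.assoc] at h₂
      simp only [h₂]
      apply pullback.hom_ext <;> simp
    · rw [hp₁]
      simp only [mk_e, mk_b, mk_a]
      rw [← Category.id_comp p₂, hp₂]
      simp only [Category.id_comp]
      congr 1
      rw [Translation.ap_ap _ _ _ _ hb hn]
      simp only [hn', Translation.ap_section]
    · rw [hp₂]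
      simp only [mk_e, reassoc_of% mk_b, mk_a]
      rw [← Category.id_comp p₁, hp₁]
      simp only [Category.id_comp, hsymm]
    · intro T x y h
      rw [hp₂, hp₁] at h
      obtain ⟨h₁, h₂⟩ := hab h
      have hyx : (y ≫ rb) ≫ (OpExt.unit ξ).f = (x ≫ rb) ≫ (OpExt.unit ξ).f := by
        rw [← hT x hb, h₁, Translation.ap_f, hT y hb]
      -- If `e = e' + b'` and `m b + a = a'`, the composite of `(e, b, a)` and `(e', b', a')` is
      -- `(e', b' + b, a)`; additivity of `m` gives its second endpoint.
      refine ⟨mk (y ≫ re) ((addition ξ).ap (y ≫ rb) (x ≫ rb) hyx) (x ≫ ra)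
        (by rw [Translation.ap_f, hT y hb]) (by rw [← hT x ha, h₁, Translation.ap_f]), ?_, ?_⟩
      · rw [hp₁, hp₁]
        simp only [mk_e, mk_b, mk_a]
        simp only [h₁]
        congr 1
        rw [Translation.ap_ap _ _ _ _ (hT y hb) hyx]
      · rw [hp₂, hp₂]
        simp only [mk_e, reassoc_of% mk_b, mk_a]
        simp only [← h₂, add_comp m hm, Category.assoc]
        congr 1
        rw [Translation.ap_ap]
  refine ⟨F, q, hq, ?_, ?_⟩
  · intro T e b a h h'
    have := congr(mk e b a h h' ≫ $hpb.w)
    rw [← Category.assoc, ← Category.assoc, hp₁, hp₂] at this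
    simpa only [mk_e, mk_a, mk_b, reassoc_of% mk_b] using this
  · intro T x y hxy
    obtain ⟨z, rfl, rfl⟩ := IsPullback.exists_lift hpb x y hxy
    refine ⟨z ≫ re, z ≫ rb, z ≫ ra, hT z hb, hT z ha, hp₁ z, ?_⟩
    rw [hp₂ z]
    simp only [Category.assoc]

/-- The push forward of `X` along a morphism of actions `(1, φ₁)` exists. -/
theorem exists_pushForward (X : OpExt ξ) (hφ : IsEquivariant ξ η (𝟙 C) φ₁) :
    ∃ (F : OpExt η) (u : HomOver (𝟙 C) φ₁ X.toAbExt F.toAbExt), IsPushForward X.toAbExt F u := by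
  obtain ⟨m, hm⟩ := hφ.exists_unit_map
  obtain ⟨F, q, hq, rel, rel'⟩ := exists_balanced_quotient X m hm
  have hAm : Mono (OpExt.unit η).k := (OpExt.unit η).ker.mono
  have hab {T : 𝒞} {e e' : T ⟶ X.E} {a a' : T ⟶ (OpExt.unit η).E} {h h'}
      (h0 : pullback.lift e a h = (pullback.lift e' a' h' : T ⟶ pullback X.f (OpExt.unit η).f)) :
      e = e' ∧ a = a' :=
    ⟨by simpa using congr($h0 ≫ pullback.fst _ _), by simpa using congr($h0 ≫ pullback.snd _ _)⟩
  have hcong {T : 𝒞} {e e' : T ⟶ X.E} {a a' : T ⟶ (OpExt.unit η).E}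
      {h : e ≫ X.f = a ≫ (OpExt.unit η).f}
      {h' : e' ≫ X.f = a' ≫ (OpExt.unit η).f} (h₁ : e = e') (h₂ : a = a') :
      pullback.lift e a h ≫ q = pullback.lift e' a' h' ≫ q := by subst h₁; subst h₂; rfl
  -- Maps out of the quotient are balanced maps out of `X ×_C A'`.
  have desc {Y : 𝒞} (d : pullback X.f (OpExt.unit η).f ⟶ Y) (hd : ∀ {T : 𝒞} (e : T ⟶ X.E)
      (b : T ⟶ (OpExt.unit ξ).E) (a : T ⟶ (OpExt.unit η).E)
      (h : e ≫ X.f = b ≫ (OpExt.unit ξ).f) (h' : e ≫ X.f = a ≫ (OpExt.unit η).f),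
      pullback.lift (X.translation.ap e b h) a (by rw [Translation.ap_f, h']) ≫ d =
        pullback.lift e ((addition η).ap (b ≫ m.hom) a (by simp [m.comm_f, ← h, h']))
          (by simp [m.comm_f, h]) ≫ d) : ∃ t : F ⟶ Y, q ≫ t = d := by
    have : ∀ {Z : 𝒞} (g₁ g₂ : Z ⟶ pullback X.f
        (OpExt.unit η).f), g₁ ≫ q = g₂ ≫ q → g₁ ≫ d = g₂ ≫ d := by
      intro Z g₁ g₂ hg
      obtain ⟨e, b, a, h, h', rfl, rfl⟩ := rel' g₁ g₂ hg
      exact hd e b a h h'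
    exact ⟨EffectiveEpi.desc q d this, EffectiveEpi.fac q d this⟩
  -- the projection and the kernel
  obtain ⟨f, hf⟩ := desc (pullback.fst _ _ ≫ X.f) (fun e b a h h' => by simp)
  have hf' {T : 𝒞} (e : T ⟶ X.E) (a : T ⟶ (OpExt.unit η).E) (h : e ≫ X.f = a ≫ (OpExt.unit η).f) :
      (pullback.lift e a h ≫ q) ≫ f = e ≫ X.f := by simp [hf]
  let k : B' ⟶ F := pullback.lift 0 (OpExt.unit η).k (by simp) ≫ q
  have hk {T : 𝒞} (b : T ⟶ B') : b ≫ k = pullback.lift 0 (b ≫ (OpExt.unit η).k) (by simp) ≫ q := by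
    rw [← Category.assoc, comp_pullback_lift]
    exact hcong comp_zero rfl
  have hfs : IsRegularEpi f := by
    have := X.regEpi
    have := (OpExt.unit η).regEpi
    have : StrongEpi (q ≫ f) := by
      rw [hf]
      exact strongEpi_comp _ _
    have := strongEpi_of_strongEpi q f
    infer_instance
  have hker : IsKer k f := by
    refine IsKer.of_local_lift (by rw [hf', zero_comp]) ⟨fun {T} x y hxy => ?_⟩ fun {T} x hx => ?_
    · rw [hk, hk] at hxy
      obtain ⟨e, b, a, h, h', h₁, h₂⟩ := rel' _ _ hxy
      obtain ⟨h₃, h₄⟩ := hab h₁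
      obtain ⟨h₅, h₆⟩ := hab h₂
      -- If `(0, x)` and `(0, y)` are related through `(e, b, a)`, then `e = 0` and `e + b = 0`, so
      -- `b = 0`.
      have hb : b = 0 := X.translation.ap_injective X.ker (x := e) (ha := h)
        (hb := by rw [h, ← h, ← h₅, zero_comp, zero_comp])
        (h₃.symm.trans (h₅.trans (Translation.ap_zero _ _ _).symm))
      rw [← cancel_mono (OpExt.unit η).k, h₄, h₆]
      simp only [hb, zero_comp, Translation.zero_add]
    · let z : pullback x q ⟶ pullback X.f (OpExt.unit η).f := pullback.snd _ _
      have hz : pullback.fst x q ≫ x = z ≫ q := pullback.condition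
      have hz₁ : (z ≫ pullback.fst _ _) ≫ X.f = 0 := by
        rw [Category.assoc, ← hf, ← reassoc_of% hz, hx, comp_zero]
      -- A local representative of an element killed by `f` has first component in `B`. The relation
      -- moves it into the second, which then lies in `B'`.
      obtain ⟨b, hb⟩ := X.ker.exists_lift (z ≫ pullback.fst _ _) hz₁
      have hz₂ : (z ≫ pullback.snd _ _) ≫ (OpExt.unit η).f = 0 := by
        rw [Category.assoc, ← pullback.condition, ← Category.assoc, hz₁]
      have hbA : ((b ≫ (OpExt.unit ξ).k) ≫ m.hom) ≫ (OpExt.unit η).f =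
          (z ≫ pullback.snd _ _) ≫ (OpExt.unit η).f := by
        rw [hz₂]; simp [m.comm_f]
      obtain ⟨y, hy⟩ := (OpExt.unit η).ker.exists_lift
          ((addition η).ap ((b ≫ (OpExt.unit ξ).k) ≫ m.hom)
        (z ≫ pullback.snd _ _) hbA) (by rw [Translation.ap_f, hbA, hz₂])
      refine ⟨_, pullback.fst x q, y, inferInstance, ?_⟩
      rw [hz, hk, eq_pullback_lift z]
      refine Eq.trans ?_ ((rel 0 (b ≫ (OpExt.unit ξ).k) (z ≫ pullback.snd _ _) (by simp)
        (by rw [hz₂, zero_comp])).symm.trans ?_)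
      · exact hcong rfl hy
      · exact hcong (by rw [Translation.zero_ap_ker, hb]) rfl
  -- the translation
  obtain ⟨τ, hτ⟩ : ∃ τ : pullback f (OpExt.unit η).f ⟶ F, ∀ {T : 𝒞} (e : T ⟶ X.E)
      (a w : T ⟶ (OpExt.unit η).E)
      (h : e ≫ X.f = a ≫ (OpExt.unit η).f) (h' : a ≫ (OpExt.unit η).f = w ≫ (OpExt.unit η).f),
      pullback.lift (pullback.lift e a h ≫ q) w (by rw [hf', h, h']) ≫ τ =
        pullback.lift e ((addition η).ap a w h') (by rw [Translation.ap_f, h]) ≫ q := by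
    -- The translation `((e, a), w) ↦ (e, a + w)` is defined on the cover `S` of `F ×_C A'`,
    -- obtained by pulling back `q`, and then descended.
    let S := pullback (pullback.fst f (OpExt.unit η).f) q
    let c : S ⟶ pullback f (OpExt.unit η).f := pullback.fst _ _
    let z : S ⟶ pullback X.f (OpExt.unit η).f := pullback.snd _ _
    have hc : c ≫ pullback.fst f (OpExt.unit η).f = z ≫ q := pullback.condition
    have hcr : IsRegularEpi c := inferInstance
    have hzw : (z ≫ pullback.snd _ _) ≫ (OpExt.unit η).f =
        (c ≫ pullback.snd _ _) ≫ (OpExt.unit η).f := by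
      rw [Category.assoc c, ← pullback.condition (f := f), ← Category.assoc, hc, Category.assoc,
        Category.assoc, hf, pullback.condition]
    let d : S ⟶ F := pullback.lift (z ≫ pullback.fst _ _)
      ((addition η).ap (z ≫ pullback.snd _ _) (c ≫ pullback.snd _ _) hzw)
      (by rw [Translation.ap_f]; simp [pullback.condition]) ≫ q
    have hd {T : 𝒞} (g : T ⟶ S) (e : T ⟶ X.E) (a w : T ⟶ (OpExt.unit η).E)
        (h : e ≫ X.f = a ≫ (OpExt.unit η).f)
        (h' : a ≫ (OpExt.unit η).f = w ≫ (OpExt.unit η).f) (h₁ : g ≫ z = pullback.lift e a h)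
        (h₂ : (g ≫ c) ≫ pullback.snd _ _ = w) :
        g ≫ d = pullback.lift e ((addition η).ap a w h') (by rw [Translation.ap_f, h]) ≫ q := by
      simp only [d]
      rw [← Category.assoc, comp_pullback_lift]
      rw [Category.assoc] at h₂
      refine hcong ?_ ?_
      · rw [← Category.assoc, h₁, pullback.lift_fst]
      · simp only [Translation.comp_ap, reassoc_of% h₁, pullback.lift_snd, h₂]
    have : ∀ {Z : 𝒞} (g₁ g₂ : Z ⟶ S), g₁ ≫ c = g₂ ≫ c → g₁ ≫ d = g₂ ≫ d := by
      intro Z g₁ g₂ hg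
      have h₀ : (g₁ ≫ z) ≫ q = (g₂ ≫ z) ≫ q := by
        rw [Category.assoc, ← hc, reassoc_of% hg, hc, Category.assoc]
      -- Independence of the representative: `(e + b, a + w)` is related to `(e, m b + (a + w))`,
      -- and associativity identifies this with `(e, (m b + a) + w)`.
      obtain ⟨e, b, a, h, h', h₁, h₂⟩ := rel' _ _ h₀
      have haw : a ≫ (OpExt.unit η).f = ((g₁ ≫ c) ≫ pullback.snd _ _) ≫ (OpExt.unit η).f := by
        have := congr(g₁ ≫ $hzw)
        rw [← Category.assoc, ← Category.assoc, h₁, pullback.lift_snd] at this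
        simpa using this
      have hbm : (b ≫ m.hom) ≫ (OpExt.unit η).f = a ≫ (OpExt.unit η).f := by
        rw [← h', h, Category.assoc, m.comm_f, Category.comp_id]
      rw [hd g₁ _ _ _ _ haw h₁ rfl, hd g₂ e
        ((addition η).ap (b ≫ m.hom) a hbm) ((g₁ ≫ c) ≫ pullback.snd _ _)
        (by rw [Translation.ap_f, hbm, h'])
        (by rw [Translation.ap_f, hbm, haw]) h₂ (by rw [← hg]), rel _ _ _ h
            (by rw [Translation.ap_f, h'])]
      exact hcong rfl ((addition η).ap_ap _ _ _ hbm haw).symm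
    refine ⟨EffectiveEpi.desc c d this, ?_⟩
    intro T e a w h h'
    let g : T ⟶ S := pullback.lift (pullback.lift (pullback.lift e a h ≫ q) w
      (by rw [hf', h, h'])) (pullback.lift e a h) (pullback.lift_fst _ _ _)
    have hgc : g ≫ c = pullback.lift (pullback.lift e a h ≫ q) w (by rw [hf', h, h']) :=
      pullback.lift_fst _ _ _
    rw [← hgc, Category.assoc, EffectiveEpi.fac c d this]
    exact hd g e a w h h' (pullback.lift_snd _ _ _) (by rw [hgc, pullback.lift_snd])
  let t : Translation η k f :=
    { map := τ
      map_f := by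
        let c : pullback (pullback.fst f (OpExt.unit η).f) q ⟶ pullback f (OpExt.unit η).f :=
            pullback.fst _ _
        let z : pullback (pullback.fst f (OpExt.unit η).f) q ⟶ pullback X.f (OpExt.unit η).f :=
            pullback.snd _ _
        have hc : c ≫ pullback.fst f (OpExt.unit η).f = z ≫ q := pullback.condition
        have hcr : IsRegularEpi c := inferInstance
        have hzw : (z ≫ pullback.snd _ _) ≫ (OpExt.unit η).f =
            (c ≫ pullback.snd _ _) ≫ (OpExt.unit η).f := by
          rw [Category.assoc c, ← pullback.condition (f := f), ← Category.assoc, hc,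
            Category.assoc, Category.assoc, hf, pullback.condition]
        have e : c = pullback.lift (pullback.lift (z ≫ pullback.fst _ _) (z ≫ pullback.snd _ _)
            (by simp [pullback.condition]) ≫ q) (c ≫ pullback.snd _ _)
            (by rw [hf', ← hzw]; simp [pullback.condition]) := by
          apply pullback.hom_ext
          · rw [pullback.lift_fst, hc, ← eq_pullback_lift]
          · rw [pullback.lift_snd]
        have hτz := hτ (z ≫ pullback.fst _ _) (z ≫ pullback.snd _ _) (c ≫ pullback.snd _ _)
          (by simp [pullback.condition]) hzw
        rw [← e] at hτz
        rw [← cancel_epi c, reassoc_of% hτz, reassoc_of% hc, hf,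
          pullback.lift_fst_assoc, Category.assoc]
      lift_zero := by
        rw [← cancel_epi q, ← Category.assoc, comp_pullback_lift]
        simp only [Category.comp_id]
        have := hτ (pullback.fst _ _) (pullback.snd X.f (OpExt.unit η).f)
          ((pullback.fst _ _ ≫ X.f) ≫ OpExt.unitSection η) pullback.condition
          (by simp [pullback.condition])
        simp only [Translation.ap_section] at this
        have e : pullback.lift (pullback.fst _ _)
            (pullback.snd X.f (OpExt.unit η).f) pullback.condition =
            𝟙 _ := by apply pullback.hom_ext <;> simp
        simpa only [e, Category.id_comp, Category.comp_id, reassoc_of% hf, Category.assoc]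
          using this
      lift_ker := by
        have := hτ (0 : B' ⟶ X.E) 0 (OpExt.unit η).k (by simp) (by simp)
        have e : (pullback.lift 0 0 (by simp) : B' ⟶ pullback X.f (OpExt.unit η).f) = 0 := by
          apply pullback.hom_ext <;> simp
        simpa only [e, zero_comp, Translation.zero_ap_ker'] using this }
  -- The translation supplies both the Mal'tsev operation and the proof that `η` is the induced
  -- action.
  let F' : OpExt η := ⟨⟨F, k, f, hker, hfs, t.maltsev hker⟩, t.induces⟩
  let u : X.E ⟶ F := pullback.lift (𝟙 _) (X.f ≫ OpExt.unitSection η) (by simp) ≫ q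
  refine ⟨F', ⟨u, ?_, ?_⟩, ?_⟩
  · change _ = φ₁ ≫ k
    rw [hk]
    simp only [u]
    rw [← Category.assoc, comp_pullback_lift]
    -- For `b` in `B`, `(0 + b, 0)` is related to `(0, m b)`, and `m` restricts to `φ₁` on kernels.
    refine Eq.trans (hcong ?_ ?_) ((rel 0 (OpExt.unit ξ).k 0 (by simp) (by simp)).trans
      (hcong rfl ?_))
    · simp
    · rw [← Category.assoc, X.k_f, zero_comp]
    · rw [Translation.ap_zero, m.comm_k]
  · change u ≫ f = _
    rw [hf']; simp
  · intro D ζ G ψ hψ v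
    obtain ⟨n, hn⟩ := hψ.exists_unit_map
    have hdf : (pullback.fst X.f (OpExt.unit η).f ≫ v.hom) ≫ G.f =
        (pullback.snd X.f (OpExt.unit η).f ≫ n.hom) ≫ (OpExt.unit ζ).f := by
      simp [v.comm_f, n.comm_f, pullback.condition]
    -- The extension is `(e, a) ↦ v e + n a`. It is balanced because `v (e + b) = v e + n (m b)`, by
    -- `ap_comp` for the composite `mn`.
    obtain ⟨w, hw⟩ := desc (G.translation.ap (pullback.fst _ _ ≫ v.hom)
        (pullback.snd _ _ ≫ n.hom) hdf) (by
      intro T e b a h h'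
      let mn : HomOver (𝟙 C) (φ₁ ≫ ψ) (OpExt.unit ξ).toAbExt (OpExt.unit ζ).toAbExt :=
        ⟨m.hom ≫ n.hom, (m.comp n).comm_k, by simp [n.comm_f, m.comm_f]⟩
      have hmn : OpExt.unitSection ξ ≫ mn.hom = OpExt.unitSection ζ := by
        simp only [mn, reassoc_of% hm, hn]
      have hbm : (b ≫ m.hom) ≫ (OpExt.unit η).f = a ≫ (OpExt.unit η).f := by
        rw [← h', h, Category.assoc, m.comm_f, Category.comp_id]
      have e₁ := X.translation.ap_comp G.translation mn hmn v.hom v.comm_k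
        (by rw [v.comm_f, Category.comp_id]) e b h
      simp only [Translation.comp_ap, pullback.lift_fst_assoc, pullback.lift_snd_assoc, e₁,
        add_comp n hn]
      rw [Translation.ap_ap]
      · simp only [mn, Category.assoc]
      · simpa [mn, n.comm_f] using hbm)
    have hdom : u ≫ w = v.hom := by
      simp only [u, Category.assoc, hw, Translation.comp_ap, pullback.lift_fst_assoc,
        pullback.lift_snd_assoc, hn, Translation.ap_section, Category.id_comp]
    refine ⟨⟨w, ?_, ?_⟩, hdom, ?_⟩
    · change k ≫ w = _
      simp only [k, Category.assoc, hw, Translation.comp_ap, pullback.lift_fst_assoc,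
        pullback.lift_snd_assoc, zero_comp, n.comm_k, Translation.zero_ap_ker]
    · change w ≫ G.f = f ≫ _
      have : Epi q := inferInstance
      rw [← cancel_epi q, reassoc_of% hw, Translation.ap_f, reassoc_of% hf]
      simp [v.comm_f]
    -- A competitor is fixed on the image of `u` and on the kernel `B'`, and these cover `X ×_C A'`.
    · intro w' hw'
      apply HomOver.ext
      change w'.hom = w
      rw [← cancel_epi q]
      apply OpExt.pullback_unit_hom_ext
      · refine (Category.assoc _ _ _).symm.trans (Eq.trans ?_ (Category.assoc _ _ _))
        exact hw'.trans hdom.symm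
      · have h₁ : k ≫ w'.hom = ψ ≫ G.k := w'.comm_k
        have h₂ : k ≫ w = ψ ≫ G.k := by
          simp only [k, Category.assoc, hw, Translation.comp_ap, pullback.lift_fst_assoc,
            pullback.lift_snd_assoc, zero_comp, n.comm_k, Translation.zero_ap_ker]
        refine (Category.assoc _ _ _).symm.trans (Eq.trans ?_ (Category.assoc _ _ _))
        exact h₁.trans h₂.symm

end PushForward

/-! ### Translations by sections, and the identification of `π₁` with `Aut X`. -/

section Torsor

variable {C B B' : 𝒞} {η : AbAction C B'} {φ : B ⟶ B'}

/-- Every morphism of `OPEXT(C, B, ξ)` is invertible. -/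
def OpExt.isoOfHom {X Y : OpExt η} (g : X ⟶ Y) : X ≅ Y :=
  have := X.regEpi
  have h : IsIso g.hom := isIso_of_shortFive X.ker Y.ker (𝟙 B') g.hom g.comm_k
    (by rw [g.comm_f, Category.comp_id])
  { hom := g
    inv := ⟨inv g.hom, by rw [IsIso.comp_inv_eq, Category.assoc, g.comm_k]; simp,
      by rw [IsIso.inv_comp_eq, ← Category.assoc, g.comm_f]; simp⟩
    hom_inv_id := HomOver.ext (IsIso.hom_inv_id g.hom)
    inv_hom_id := HomOver.ext (IsIso.inv_hom_id g.hom) }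

theorem OpExt.id_hom (X : OpExt η) : HomOver.hom (𝟙 X) = 𝟙 X.E := rfl

theorem OpExt.comp_hom {X Y Z : OpExt η} (g : X ⟶ Y) (h : Y ⟶ Z) :
    HomOver.hom (g ≫ h) = g.hom ≫ h.hom := rfl

theorem OpExt.section_hom_f (a : OpExt.unit η ⟶ OpExt.unit η) :
    OpExt.unitSection η ≫ a.hom ≫ (OpExt.unit η).f = 𝟙 C := by
  rw [a.comm_f]; simp

theorem OpExt.section_hom_f_assoc (a : OpExt.unit η ⟶ OpExt.unit η) {Z : 𝒞} (z : C ⟶ Z) :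
    OpExt.unitSection η ≫ a.hom ≫ (OpExt.unit η).f ≫ z = z := by
  simpa using congr($(OpExt.section_hom_f a) ≫ z)

attribute [local simp] OpExt.section_hom_f OpExt.section_hom_f_assoc

/-- An endomorphism of the semidirect product extension is the translation by its value at the
zero section. -/
theorem OpExt.unit_endo_eq (a : OpExt.unit η ⟶ OpExt.unit η) :
    a.hom = (addition η).ap (𝟙 _) ((OpExt.unit η).f ≫ OpExt.unitSection η ≫ a.hom) (by simp) := by
  apply OpExt.unit_hom_ext
  · have := Translation.section_add (𝟙 C) (OpExt.unitSection η ≫ a.hom) (by simp)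
    simp only [Category.id_comp] at this
    simp [this]
  · simp only [Translation.comp_ap, ← Category.assoc, (OpExt.unit η).k_f, zero_comp]
    simp [a.comm_k]

/-- The endomorphism `x ↦ x + a(0)` of the extension `X`. -/
def OpExt.translate (X : OpExt η) (a : OpExt.unit η ⟶ OpExt.unit η) : X ⟶ X where
  hom := X.translation.ap (𝟙 X.E) (X.f ≫ OpExt.unitSection η ≫ a.hom) (by simp)
  comm_k := by
    simp only [Translation.comp_ap, ← Category.assoc, X.k_f, zero_comp]
    simp
  comm_f := by simp

theorem OpExt.comp_translate (X : OpExt η) (a : OpExt.unit η ⟶ OpExt.unit η) {T : 𝒞}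
    (x : T ⟶ X.E) : x ≫ (X.translate a).hom =
      X.translation.ap x ((x ≫ X.f) ≫ OpExt.unitSection η ≫ a.hom) (by simp) := by
  simp [OpExt.translate]

/-- By `unit_endo_eq`, `b(a(0)) = a(0) + b(0)`, so translating by `(a ≫ b)(0)` is translating by
`a(0)` and then by `b(0)`. -/
theorem OpExt.translate_comp (X : OpExt η) (a b : OpExt.unit η ⟶ OpExt.unit η) :
    X.translate (a ≫ b) = X.translate a ≫ X.translate b := by
  apply HomOver.ext
  rw [OpExt.comp_hom, OpExt.comp_translate]
  simp only [OpExt.translate, Translation.ap_f, OpExt.comp_hom, Category.id_comp]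
  rw [Translation.ap_ap]
  · have h := congr(OpExt.unitSection η ≫ a.hom ≫ $(OpExt.unit_endo_eq b))
    congr 1
    simp only [h]
    simp
  · simp

/-- The content is `x + a(y) = (x + y) + a(0)`. At `y = 0` both sides are `x + a(0)`, and on `B`
both are the kernel inclusion because `a` fixes `B`. -/
theorem idTimes_comp_translation (X : OpExt η) (a : OpExt.unit η ⟶ OpExt.unit η) :
    idTimes X a ≫ X.translation.map = X.translation.map ≫ (X.translate a).hom := by
  have e : idTimes X a ≫ X.translation.map = X.translation.ap (pullback.fst _ _)
    (pullback.snd _ _ ≫ a.hom) (by simp [a.comm_f, pullback.condition]) := rfl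
  rw [OpExt.comp_translate, e]
  apply OpExt.pullback_unit_hom_ext
  · simp only [Translation.comp_ap, ← Category.assoc, X.translation.lift_zero]
    simp
  · simp only [Translation.comp_ap, ← Category.assoc, X.translation.lift_ker, X.k_f, zero_comp]
    simp [a.comm_k]

theorem isTranslation (X : OpExt η) : IsTranslation X X.translation.map :=
  ⟨X.translation.map_f, X.translation.lift_zero, X.translation.lift_ker⟩

/-- The endomorphisms of the semidirect product extension act simply transitively on the morphisms
from an extension `Y` to `X` that induce a given morphism of actions. -/
theorem existsUnique_translate (X : OpExt η) (Y : AbExt C B) (g g' : HomOver (𝟙 C) φ Y X.toAbExt) :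
    ∃! a : OpExt.unit η ⟶ OpExt.unit η, g.hom ≫ (X.translate a).hom = g'.hom := by
  have := Y.regEpi
  have hgf : g.hom ≫ X.f = Y.f := by rw [g.comm_f, Category.comp_id]
  have hgf' : g'.hom ≫ X.f = Y.f := by rw [g'.comm_f, Category.comp_id]
  refine existsUnique_of_exists_of_unique ?_ fun a b ha hb => ?_
  -- `δ = g' - g` vanishes on the kernel of `Y`, where `g` and `g'` agree, hence descends to a
  -- section `t` of the Beck module.
  · obtain ⟨δ, hδ, h⟩ := X.translation.exists_ap_eq X.ker g.hom g'.hom (hgf.trans hgf'.symm)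
    have hk : Y.k ≫ δ = 0 := by
      refine X.translation.ap_injective X.ker (x := Y.k ≫ g.hom) (ha := by simp [hδ])
        (hb := by simp [hgf]) ?_
      rw [← Translation.comp_ap, h, Translation.ap_zero, g.comm_k, g'.comm_k]
      exact hδ
    obtain ⟨t, rfl⟩ := exists_desc Y.ker δ hk
    have ht : t ≫ (OpExt.unit η).f = 𝟙 C := by
      have : Epi Y.f := inferInstance
      rw [← cancel_epi Y.f, ← Category.assoc, ← hδ, hgf, Category.comp_id]
    -- The endomorphism `x ↦ x + t` has value `t` at the zero section.
    let a : OpExt.unit η ⟶ OpExt.unit η :=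
      { hom := (addition η).ap (𝟙 _) ((OpExt.unit η).f ≫ t) (by simp [ht])
        comm_k := by
          simp only [Translation.comp_ap, ← Category.assoc, (OpExt.unit η).k_f, zero_comp]
          simp
        comm_f := by simp }
    have hsa : OpExt.unitSection η ≫ a.hom = t := by
      have := Translation.section_add (𝟙 C) t (by simp [ht])
      simp only [Category.id_comp] at this
      simp [a, this]
    refine ⟨a, ?_⟩
    rw [OpExt.comp_translate]
    simp only [hsa, hgf, h]
  -- Uniqueness of differences gives `a(0) = b(0)`; both endomorphisms fix the kernel, so they
  -- coincide.
  · have h := hb.trans ha.symm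
    rw [OpExt.comp_translate, OpExt.comp_translate] at h
    have h := X.translation.ap_injective X.ker h
    have : Epi Y.f := inferInstance
    rw [hgf, cancel_epi] at h
    exact HomOver.ext (OpExt.unit_hom_ext h.symm (by rw [a.comm_k, b.comm_k]))

/-- The canonical homomorphism from `π₁` to the automorphism group of an extension. -/
def OpExt.translateHom (X : OpExt η) : Pi1 η →* Aut X :=
  MonoidHom.mk' (fun a : Pi1 η => (OpExt.isoOfHom (X.translate a.hom) : Aut X))
    -- The product `a * b` in `Aut` is `b` followed by `a`, hence the reversed arguments.
    fun a b => Iso.ext (X.translate_comp b.hom a.hom)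

/-- This is simple transitivity for `Y = X`, comparing the identity with a given automorphism; the
resulting endomorphism is invertible by the short five lemma. -/
theorem OpExt.translateHom_bijective (X : OpExt η) : Function.Bijective X.translateHom := by
  have key (c : Aut X) := existsUnique_translate X X.toAbExt (𝟙 X) c.hom
  simp only [OpExt.id_hom, Category.id_comp] at key
  refine ⟨fun a b h => ?_, fun c => ?_⟩
  · have h' : X.translate a.hom = X.translate b.hom := congr(Iso.hom $h)
    exact Iso.ext ((key (X.translateHom b)).unique congr(HomOver.hom $h') rfl)
  · obtain ⟨a, ha, -⟩ := key c
    exact ⟨OpExt.isoOfHom a, Iso.ext (HomOver.ext ha)⟩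

/-- The canonical isomorphism from `π₁` to the automorphism group of an extension. -/
def OpExt.autEquiv (X : OpExt η) : Pi1 η ≃* Aut X :=
  MulEquiv.ofBijective X.translateHom X.translateHom_bijective

end Torsor

/-! ### Reduction from morphisms over `φ₀` to morphisms over `C`. -/

section BaseChange

variable {C B C' B' : 𝒞} {φ₀ : C ⟶ C'} {φ₁ : B ⟶ B'} {ξ' : AbAction C' B'}

/-- Morphisms over `φ₀` correspond to morphisms to the pullback along `φ₀`. -/
def HomOver.ofBaseChange {X : AbExt C B} {Y : OpExt ξ'}
    (v : HomOver (𝟙 C) φ₁ X (Y.baseChange φ₀).toAbExt) : HomOver φ₀ φ₁ X Y.toAbExt where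
  hom := v.hom ≫ (Y.baseChangeFst φ₀).hom
  comm_k := by simpa [HomOver.comp] using (v.comp (Y.baseChangeFst φ₀)).comm_k
  comm_f := by simpa [HomOver.comp] using (v.comp (Y.baseChangeFst φ₀)).comm_f

theorem HomOver.toBaseChange_ofBaseChange {X : AbExt C B} {Y : OpExt ξ'}
    (v : HomOver (𝟙 C) φ₁ X (Y.baseChange φ₀).toAbExt) : v.ofBaseChange.toBaseChange = v := by
  apply HomOver.ext
  have := v.comm_f
  rw [Category.comp_id] at this
  apply pullback.hom_ext
  · exact pullback.lift_fst _ _ _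
  · exact (pullback.lift_snd _ _ _).trans this.symm

theorem HomOver.ofBaseChange_toBaseChange {X : AbExt C B} {Y : OpExt ξ'}
    (g : HomOver φ₀ φ₁ X Y.toAbExt) : g.toBaseChange.ofBaseChange = g :=
  HomOver.ext (pullback.lift_fst _ _ _)

theorem IsEquivariant.restrict {ξ : AbAction C B} (h : IsEquivariant ξ ξ' φ₀ φ₁) :
    IsEquivariant ξ (ξ'.restrict φ₀) (𝟙 C) φ₁ := by
  unfold IsEquivariant at h ⊢
  rw [← h, show (ξ'.restrict φ₀).act = flatMap φ₀ (𝟙 B') ≫ ξ'.act from rfl, ← Category.assoc,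
    flatMap_comp, Category.id_comp, Category.comp_id]

theorem IsEquivariant.id (ξ : AbAction C B) : IsEquivariant ξ ξ (𝟙 C) (𝟙 B) := by
  rw [IsEquivariant, flatMap_id, Category.id_comp, Category.comp_id]

/-- The morphism `v` followed by the endomorphism `w`. -/
def HomOver.compHom {X : AbExt C B} {η : AbAction C B'} {Y Z : OpExt η}
    (v : HomOver (𝟙 C) φ₁ X Y.toAbExt) (w : Y ⟶ Z) : HomOver (𝟙 C) φ₁ X Z.toAbExt where
  hom := v.hom ≫ w.hom
  comm_k := by simpa [HomOver.comp] using (v.comp w).comm_k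
  comm_f := by simpa [HomOver.comp] using (v.comp w).comm_f

/-- A push forward of `X` is isomorphic to every extension to which `X` maps. -/
theorem IsPushForward.nonempty_iso {X : AbExt C B} {η : AbAction C B'} {F Y : OpExt η}
    {u : HomOver (𝟙 C) φ₁ X F.toAbExt} (h : IsPushForward X F u)
    (v : HomOver (𝟙 C) φ₁ X Y.toAbExt) : Nonempty (Y ≅ F) := by
  -- The universal property is used with `ψ = 𝟙`, so `v` is reread as lying over `φ₁ ≫ 𝟙`; the
  -- factor it gives lies in a fibre, where all morphisms are invertible.
  obtain ⟨w, -, -⟩ := h η Y (𝟙 B') (IsEquivariant.id η) ⟨v.hom, by simpa using v.comm_k, v.comm_f⟩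
  exact ⟨(OpExt.isoOfHom (X := F) (Y := Y) w).symm⟩

/-- `π₁` acts on the morphisms of extensions over `φ₀`. -/
@[reducible]
def homOverMulAction (X : AbExt C B) (Y : OpExt ξ') :
    MulAction (Pi1 (ξ'.restrict φ₀)) (HomOver φ₀ φ₁ X Y.toAbExt) where
  smul a g := (g.toBaseChange.compHom ((Y.baseChange φ₀).autEquiv a).hom).ofBaseChange
  one_smul g := by
    change (g.toBaseChange.compHom ((Y.baseChange φ₀).autEquiv 1).hom).ofBaseChange = g
    rw [map_one]
    conv_rhs => rw [← g.ofBaseChange_toBaseChange]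
    congr 1
    exact HomOver.ext (Category.comp_id _)
  mul_smul a b g := by
    change (g.toBaseChange.compHom ((Y.baseChange φ₀).autEquiv (a * b)).hom).ofBaseChange =
      ((g.toBaseChange.compHom ((Y.baseChange φ₀).autEquiv b).hom).ofBaseChange.toBaseChange.compHom
        ((Y.baseChange φ₀).autEquiv a).hom).ofBaseChange
    -- Between two successive actions, the passage down to `E'` and back up to the pullback cancels.
    rw [map_mul, HomOver.toBaseChange_ofBaseChange]
    congr 1
    exact HomOver.ext (Category.assoc _ _ _).symm

end BaseChange

end

end SemiAb

/-! ### The theorem. -/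

theorem theorem4p2 {𝒞 : Type u} [Category.{v} 𝒞] [HasZeroMorphisms 𝒞]
    [SemiAb.SemiAbelian 𝒞] {C B C' B' : 𝒞} (E : SemiAb.AbExt C B) (E' : SemiAb.AbExt C' B')
    (φ₀ : C ⟶ C') (φ₁ : B ⟶ B') (hφ : SemiAb.IsEquivariant E.action E'.action φ₀ φ₁) :
    -- the push forward `φ₁_*E` exists, and (i) holds for it
    ((∃ (F : SemiAb.OpExt (E'.action.restrict φ₀)) (u : SemiAb.HomOver (𝟙 C) φ₁ E F.toAbExt),
        SemiAb.IsPushForward E F u) ∧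
      ∀ (F : SemiAb.OpExt (E'.action.restrict φ₀)) (u : SemiAb.HomOver (𝟙 C) φ₁ E F.toAbExt),
        SemiAb.IsPushForward E F u →
          (Nonempty (SemiAb.HomOver φ₀ φ₁ E E') ↔ Nonempty (E'.toOpExt.baseChange φ₀ ≅ F))) ∧
    -- (ii), with the canonical action of `π₁` through the isomorphism `π₁ ≃* Aut (φ₀^*E')`
    (Nonempty (SemiAb.HomOver φ₀ φ₁ E E') →
      ∃ τ, SemiAb.IsTranslation (E'.toOpExt.baseChange φ₀) τ ∧
        ∃ θ : SemiAb.Pi1 (E'.action.restrict φ₀) ≃* Aut (E'.toOpExt.baseChange φ₀),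
          (∀ a, SemiAb.idTimes (E'.toOpExt.baseChange φ₀) a.hom ≫ τ = τ ≫ (θ a).hom.hom) ∧
          ∃ _ : MulAction (SemiAb.Pi1 (E'.action.restrict φ₀)) (SemiAb.HomOver φ₀ φ₁ E E'),
            (∀ (a : SemiAb.Pi1 (E'.action.restrict φ₀)) (g : SemiAb.HomOver φ₀ φ₁ E E'),
              (a • g).hom = (g.toBaseChange (Y := E'.toOpExt)).hom ≫ (θ a).hom.hom ≫
                (E'.toOpExt.baseChangeFst φ₀).hom) ∧
            ∀ g g' : SemiAb.HomOver φ₀ φ₁ E E',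
              ∃! a : SemiAb.Pi1 (E'.action.restrict φ₀), a • g = g') := by 
  let X := E'.toOpExt.baseChange φ₀
  refine ⟨⟨SemiAb.exists_pushForward E.toOpExt hφ.restrict, fun F u hu => ⟨?_, ?_⟩⟩, fun _ => ?_⟩
  · rintro ⟨g⟩
    exact hu.nonempty_iso (g.toBaseChange (Y := E'.toOpExt))
  · rintro ⟨i⟩
    -- The morphism is the composite of `E ⟶ F`, the isomorphism `F ≅ φ₀^*E'`, and the projection to
    -- `E'`.
    exact ⟨(u.compHom i.inv).ofBaseChange (Y := E'.toOpExt)⟩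
  · refine ⟨X.translation.map, SemiAb.isTranslation X, X.autEquiv,
      fun a => SemiAb.idTimes_comp_translation X a.hom,
      SemiAb.homOverMulAction E E'.toOpExt, fun a g => Category.assoc _ _ _, fun g g' => ?_⟩
    -- Simple transitivity is transferred from endomorphisms of the identity object to `π₁`, every
    -- such endomorphism being invertible.
    obtain ⟨a, ha, ha'⟩ := SemiAb.existsUnique_translate X E
      (g.toBaseChange (Y := E'.toOpExt)) (g'.toBaseChange (Y := E'.toOpExt))
    refine ⟨SemiAb.OpExt.isoOfHom a, ?_, fun b hb => Iso.ext (ha' _ ?_)⟩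
    · have h : (g.toBaseChange (Y := E'.toOpExt)).compHom (X.translate a) =
        g'.toBaseChange (Y := E'.toOpExt) := SemiAb.HomOver.ext ha
      exact congr(SemiAb.HomOver.ofBaseChange $h).trans
        (SemiAb.HomOver.ofBaseChange_toBaseChange (Y := E'.toOpExt) g')
    · have h : ((g.toBaseChange (Y := E'.toOpExt)).compHom
          (X.translate b.hom)).ofBaseChange (Y := E'.toOpExt) = g' := hb
      have := congr(SemiAb.HomOver.hom (SemiAb.HomOver.toBaseChange (Y := E'.toOpExt) $h))
      rwa [SemiAb.HomOver.toBaseChange_ofBaseChange] at this
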